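/- Let $G=(V,E)$ be a connected undirected graph without self-loops on $n=|V|$ nodes, let $d(i)$ be the degree of node $i$, and let the edges $\{i,j\}\in E$ carry independent Poisson processes of rates $\lambda_{ij}=1/\max\{d(i),d(j)\}$. In the quantized Metropolis dynamics every node $i$ starts with an integer value $x_i(0)\in[l,L]$ (with $l \le L$ integers), and whenever the process of an edge $\{i,j\}$ registers an arrival, the values of $i$ and $j$ are updated simultaneously: the larger of the two decreases by $1$ and the smaller increases by $1$, while nothing changes if they are equal. Let $\bar x(0)=\frac1n\sum_{i} x_i(0)$, and let the consensus set be $$\mathcal C=\Big\{x\in\mathbb Z^V \;:\; x_i\in\{\lfloor\bar x(0)\rfloor,\lfloor\bar x(0)\rfloor+1\}\text{ for all } i,\ \ \tfrac1n\sum_i x_i=\bar x(0)\Big\}.$$ **Theorem.** The expected time until the quantized Metropolis dynamics reaches the consensus set is $O(n^2\log n)$ for values in a fixed range $[l,L]$. Precisely, there is an absolute constant $K>0$ such that for every such $G$, all $l,L$ and every initial configuration $x(0)\in[l,L]^V$, the time $T=\inf\{t\ge 0: x(t)\in\mathcal C\}$ satisfies $$\mathbb E[T]\;\le\; K\,(L-l)\,n^2\log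 n .$$ -/

import Mathlib

open MeasureTheory ProbabilityTheory
open scoped NNReal ENNReal

namespace QuantizedMetropolis

/-- A (homogeneous, rate `r`) Poisson process on `[0, ∞)`: almost every path is a nondecreasing,
right-continuous `ℕ`-valued function starting from `0`, the increments are independent, and the
increment over `(s, t]` has the Poisson law of parameter `r * (t - s)`.
`N t ω` is the number of arrivals during `(0, t]`. -/
structure IsPoissonProcess {Ω : Type*} [MeasurableSpace Ω] (N : ℝ≥0 → Ω → ℕ) (r : ℝ≥0)
    (P : Measure Ω) : Prop where
  measurable : ∀ t, Measurable (N t)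
  zero : ∀ᵐ ω ∂P, N 0 ω = 0
  monotone : ∀ᵐ ω ∂P, Monotone fun t => N t ω
  rightContinuous : ∀ᵐ ω ∂P, ∀ t, ContinuousWithinAt (fun s => N s ω) (Set.Ioi t) t
  indepIncrements : HasIndepIncrements N P
  law : ∀ s t, s ≤ t → P.map (fun ω => N t ω - N s ω) = poissonMeasure (r * (t - s))

/-- The Metropolis rate `1 / max (d i) (d j)` of an edge `{i, j}`, and `0` for non-edges. -/
noncomputable def metropolisRate {V : Type*} [Fintype V] (G : SimpleGraph V)
    [DecidableRel G.Adj] (i j : V) : ℝ≥0 :=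
  if G.Adj i j then 1 / ((max (G.degree i) (G.degree j) : ℕ) : ℝ≥0) else 0

/-- The new value of a node with value `a` after an update with a node with value `b`. -/
def moveToward (a b : ℤ) : ℤ :=
  if b < a then a - 1 else if a < b then a + 1 else a

/-- The quantized consensus update of the configuration `x` along the edge `{i, j}`. -/
def quantizedUpdate {V : Type*} [DecidableEq V] (i j : V) (x : V → ℤ) : V → ℤ := fun k =>
  if k = i then moveToward (x i) (x j)
  else if k = j then moveToward (x j) (x i)
  else x k

/-- The path `x` starts at `x₀` and is driven by the edge counting functions `N`: it does not
change over `(s, t]` if no edge registers an arrival during `(s, t]`, and it undergoes the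
quantized update along `{i, j}` if a single arrival is registered during `(s, t]`, on `{i, j}`.
(For locally finite arrivals at pairwise distinct times this determines the whole path,
in its right-continuous version.) -/
structure IsQuantizedPath {V : Type*} [DecidableEq V] (G : SimpleGraph V)
    (N : G.edgeSet → ℝ≥0 → ℕ) (x₀ : V → ℤ) (x : ℝ≥0 → V → ℤ) : Prop where
  init : x 0 = x₀
  noArrival : ∀ s t, s ≤ t → (∀ e, N e t = N e s) → x t = x s
  oneArrival : ∀ s t, s ≤ t → ∀ (i j : V) (h : G.Adj i j),
    N ⟨s(i, j), h⟩ t = N ⟨s(i, j), h⟩ s + 1 →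
    (∀ e : G.edgeSet, e ≠ ⟨s(i, j), h⟩ → N e t = N e s) →
    x t = quantizedUpdate i j (x s)

/-- `X` is the quantized Metropolis dynamics on `G` started at `x₀`, on the probability space
`(Ω, P)`, driven by the independent Poisson processes `N e` (one for each edge `e = {i, j}`,
with the Metropolis rate of that edge). -/
structure IsQuantizedMetropolisDynamics {V : Type*} [Fintype V] [DecidableEq V]
    (G : SimpleGraph V) [DecidableRel G.Adj] {Ω : Type*} [MeasurableSpace Ω] (P : Measure Ω)
    (N : G.edgeSet → ℝ≥0 → Ω → ℕ) (x₀ : V → ℤ) (X : ℝ≥0 → Ω → V → ℤ) : Prop where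
  poisson : ∀ (i j : V) (h : G.Adj i j),
    IsPoissonProcess (N ⟨s(i, j), h⟩) (metropolisRate G i j) P
  indep : iIndepFun (fun (e : G.edgeSet) (ω : Ω) (t : ℝ≥0) => N e t ω) P
  measurable : ∀ t, Measurable (X t)
  path : ∀ᵐ ω ∂P, IsQuantizedPath G (fun e t => N e t ω) x₀ (fun t => X t ω)

/-- The average of the entries of a configuration. -/
def average {V : Type*} [Fintype V] (x : V → ℤ) : ℚ :=
  (∑ i, (x i : ℚ)) / (Fintype.card V : ℚ)

/-- The consensus set belonging to the initial configuration `x₀`. -/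
def consensusSet {V : Type*} [Fintype V] (x₀ : V → ℤ) : Set (V → ℤ) :=
  {x | (∀ i, x i = ⌊average x₀⌋ ∨ x i = ⌊average x₀⌋ + 1) ∧ average x = average x₀}

/-- The first time at which the path `x` is in `C` (infinite if there is no such time). -/
noncomputable def hittingTime {S : Type*} (C : Set S) (x : ℝ≥0 → S) : ℝ≥0∞ :=
  ⨅ (t : ℝ≥0) (_ : x t ∈ C), (t : ℝ≥0∞)

end QuantizedMetropolis

/-! Let m and M be the least and greatest current values, with M - m ≥ 2. An update can only move a
node of value m to a neighbour, leave it in place or destroy it, and likewise for M: the set of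
nodes with an extreme value is contained in its image under the exchange of the two endpoints. A
node of value m and a node of value M therefore behave like two walkers with Metropolis rates which
are both destroyed when their edge rings (`pairSum_quantizedUpdate_le`).

To measure how fast such pairs disappear, each pair (a, b) gets a weight w a b in [1, 2] on which
the two walks have drift at most -λ w a b off the diagonal, with λ = 1 / (48 n²)
(`exists_pair_function`). The weight is an affine function of the Green function of the walk, which
is O(n) because effective resistances are O(n): degrees along a geodesic sum to at most 3n
(`sq_sub_le_energy`). The sum W of the weights over all extreme pairs then satisfies 𝓛W ≤ -λW, where
𝓛 is the generator of the dynamics.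

While both extremes are present, 1 ≤ W ≤ 2n², so log (1 + W) has drift at most -λ/2. When an extreme
value dies out, a new logarithm of size at most Γ = log (1 + 2n²) may appear; a charge of Γ per unit
of spread above 2 pays for it. The resulting Lyapunov function, scaled by 96 n², is O((L - l) n² log
n) and has drift at most -1 outside the consensus set (`exists_lyapunov`).

The passage from drift to expected hitting time uses no continuous-time martingales. Time is cut
into intervals of length δ; with at most one arrival in each, the path on the grid is a discrete
chain whose mean increments are an exact multiple of the generator. Multiple arrivals have total
probability O(δ) on a bounded time window, and δ → 0 removes them (`lintegral_hittingTime_le`). -/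

namespace QuantizedMetropolis

/-- A path along which the distance to its starting point increases by one at each step. -/
lemma exists_geodesic {V : Type*} {G : SimpleGraph V} (hG : G.Connected) (a b : V) :
    ∃ v : ℕ → V, v 0 = a ∧ v (G.dist a b) = b ∧ (∀ s < G.dist a b, G.Adj (v s) (v (s + 1))) ∧
      ∀ s ≤ G.dist a b, G.dist a (v s) = s := by
  obtain ⟨p, hp⟩ := hG.exists_walk_length_eq_dist a b
  refine ⟨p.getVert, by simp, by simp [← hp], fun s hs => p.adj_getVert_succ (hp ▸ hs),
    fun s hs => ?_⟩
  have h1 : G.dist a (p.getVert s) ≤ s := (SimpleGraph.dist_le (p.take s)).trans (by simp)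
  have h2 : G.dist (p.getVert s) b ≤ p.length - s :=
    (SimpleGraph.dist_le (p.drop s)).trans (by simp)
  have h3 := hG.dist_triangle (u := a) (v := p.getVert s) (w := b)
  omega

/-! ### Potential theory of the Metropolis walk -/

section Green

variable {V : Type*} [Fintype V] {G : SimpleGraph V} [DecidableRel G.Adj]

lemma metropolisRate_comm (i j : V) : metropolisRate G i j = metropolisRate G j i := by
  simp [metropolisRate, G.adj_comm, max_comm]

lemma metropolisRate_self (i : V) : metropolisRate G i i = 0 := by
  simp [metropolisRate]

lemma metropolisRate_mul_max {i j : V} (h : G.Adj i j) :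
    (metropolisRate G i j : ℝ) * max (G.degree i : ℝ) (G.degree j) = 1 := by
  have hi : 0 < G.degree i := (G.degree_pos_iff_exists_adj i).2 ⟨j, h⟩
  have : (0 : ℝ) < max (G.degree i : ℝ) (G.degree j) := lt_max_of_lt_left (by exact_mod_cast hi)
  simp only [metropolisRate, if_pos h]
  push_cast
  field_simp

/-- The degrees along a geodesic sum to at most three times the number of vertices. -/
lemma sum_degree_geodesic_le (hG : G.Connected) (a : V) (v : ℕ → V) (k : ℕ)
    (hv : ∀ s ≤ k, G.dist a (v s) = s) :
    ∑ s ∈ Finset.range (k + 1), G.degree (v s) ≤ 3 * Fintype.card V := by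
  have h : ∀ s, G.degree (v s) = ∑ u : V, if G.Adj (v s) u then 1 else 0 := fun s => by
    rw [← SimpleGraph.card_neighborFinset_eq_degree, Finset.card_eq_sum_ones,
      SimpleGraph.neighborFinset_eq_filter, Finset.sum_filter]
  simp_rw [h]
  rw [Finset.sum_comm]
  calc _ ≤ ∑ u : V, 3 := Finset.sum_le_sum fun u _ => ?_
    _ = _ := by simp [mul_comm]
  -- After exchanging the sums: the geodesic vertices adjacent to u lie at distances from a within
  -- one of that of u, and there are at most three of them.
  rw [← Finset.sum_filter, ← Finset.card_eq_sum_ones]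
  refine (Finset.card_le_card (t := Finset.Icc (G.dist a u - 1) (G.dist a u + 1)) ?_).trans
    (by simp; omega)
  intro s hs
  simp only [Finset.mem_filter, Finset.mem_range] at hs
  have h1 := hv s (by omega)
  have h2 := hG.dist_triangle (u := a) (v := v s) (w := u)
  have h3 := hG.dist_triangle (u := a) (v := u) (w := v s)
  have h4 := SimpleGraph.dist_eq_one_iff_adj.2 hs.2
  have h5 := SimpleGraph.dist_eq_one_iff_adj.2 hs.2.symm
  simp only [Finset.mem_Icc]
  omega

/-- Metropolis conductances have effective resistances of order `n`. -/
lemma sq_sub_le_energy (hG : G.Connected) (φ : V → ℝ) (a b : V) :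
    (φ a - φ b) ^ 2 ≤ 6 * Fintype.card V *
      ∑ i, ∑ j, (metropolisRate G i j : ℝ) * (φ j - φ i) ^ 2 := by
  classical
  obtain ⟨v, hv0, hvk, hadj, hdist⟩ := exists_geodesic hG a b
  set k := G.dist a b
  have htel : φ b - φ a = ∑ s ∈ Finset.range k, (φ (v (s + 1)) - φ (v s)) := by
    rw [Finset.sum_range_sub (fun s => φ (v s)), hv0, hvk]
  -- Cauchy–Schwarz along the geodesic, with the resistances max (d, d') of its edges as weights.
  have hcs := Finset.sum_sq_le_sum_mul_sum_of_sq_le_mul (Finset.range k)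
    (f := fun s => max (G.degree (v s) : ℝ) (G.degree (v (s + 1))))
    (g := fun s => (metropolisRate G (v s) (v (s + 1)) : ℝ) * (φ (v (s + 1)) - φ (v s)) ^ 2)
    (r := fun s => φ (v (s + 1)) - φ (v s))
    (fun s _ => by positivity) (fun s _ => by positivity)
    (fun s hs => by
      have := metropolisRate_mul_max (hadj s (Finset.mem_range.1 hs))
      exact le_of_eq (by linear_combination -(φ (v (s + 1)) - φ (v s)) ^ 2 * this))
  have h1 : ∑ s ∈ Finset.range k, max (G.degree (v s) : ℝ) (G.degree (v (s + 1)))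
      ≤ 6 * Fintype.card V := by
    have hN := sum_degree_geodesic_le hG a v k hdist
    have hN' : ∑ s ∈ Finset.range (k + 1), (G.degree (v s) : ℝ) ≤ 3 * Fintype.card V := by
      exact_mod_cast hN
    calc _ ≤ ∑ s ∈ Finset.range k, ((G.degree (v s) : ℝ) + G.degree (v (s + 1))) :=
          Finset.sum_le_sum fun s _ => max_le (by simp) (by simp)
      _ ≤ ∑ s ∈ Finset.range (k + 1), (G.degree (v s) : ℝ)
          + ∑ s ∈ Finset.range (k + 1), (G.degree (v s) : ℝ) := by
          rw [Finset.sum_add_distrib]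
          gcongr
          · simp
          · rw [Finset.sum_range_succ' _ k]
            simp
      _ ≤ _ := by linarith
  have h2 : ∑ s ∈ Finset.range k,
      (metropolisRate G (v s) (v (s + 1)) : ℝ) * (φ (v (s + 1)) - φ (v s)) ^ 2
      ≤ ∑ i, ∑ j, (metropolisRate G i j : ℝ) * (φ j - φ i) ^ 2 := by
    rw [← Fintype.sum_prod_type' (fun i j => (metropolisRate G i j : ℝ) * (φ j - φ i) ^ 2)]
    -- The distances to a separate the steps, so they are distinct terms of the double sum.
    have hinj : Set.InjOn (fun s => (v s, v (s + 1))) (Finset.range k) := by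
      intro s hs t ht hst
      simp only [Finset.coe_range, Set.mem_Iio, Prod.mk.injEq] at hs ht hst
      have := congrArg (G.dist a) hst.1
      rwa [hdist s hs.le, hdist t ht.le] at this
    rw [← Finset.sum_image (g := fun s => (v s, v (s + 1)))
      (f := fun p : V × V => (metropolisRate G p.1 p.2 : ℝ) * (φ p.2 - φ p.1) ^ 2) hinj]
    exact Finset.sum_le_sum_of_subset_of_nonneg (Finset.subset_univ _)
      fun _ _ _ => by positivity
  calc (φ a - φ b) ^ 2 = (∑ s ∈ Finset.range k, (φ (v (s + 1)) - φ (v s))) ^ 2 := by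
        rw [← htel]; ring
    _ ≤ _ := hcs
    _ ≤ _ := mul_le_mul h1 h2 (Finset.sum_nonneg fun _ _ => by positivity) (by positivity)

/-- The generator of the random walk with Metropolis rates. -/
noncomputable def walkGenerator (G : SimpleGraph V) [DecidableRel G.Adj] (φ : V → ℝ) (i : V) : ℝ :=
  ∑ k, (metropolisRate G i k : ℝ) * (φ k - φ i)

/-- Summation by parts from the symmetry of the rates. The factor 1 / 2 appears because every edge
is counted in both orientations. -/
lemma sum_mul_walkGenerator (φ ψ : V → ℝ) :
    ∑ i, ψ i * walkGenerator G φ i =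
      -(1 / 2) * ∑ i, ∑ k, (metropolisRate G i k : ℝ) * ((φ k - φ i) * (ψ k - ψ i)) := by
  have h1 : ∑ i, ψ i * walkGenerator G φ i =
      ∑ i, ∑ k, (metropolisRate G i k : ℝ) * ((φ k - φ i) * ψ i) := by
    simp only [walkGenerator, Finset.mul_sum]
    exact Finset.sum_congr rfl fun i _ => Finset.sum_congr rfl fun k _ => by ring
  have h2 : ∑ i, ψ i * walkGenerator G φ i =
      ∑ i, ∑ k, (metropolisRate G i k : ℝ) * ((φ i - φ k) * ψ k) := by
    rw [h1, Finset.sum_comm]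
    exact Finset.sum_congr rfl fun i _ => Finset.sum_congr rfl fun k _ => by
      rw [metropolisRate_comm]
  have h3 : ∑ i, ∑ k, (metropolisRate G i k : ℝ) * ((φ k - φ i) * (ψ k - ψ i)) =
      -(∑ i, ∑ k, (metropolisRate G i k : ℝ) * ((φ i - φ k) * ψ k)) -
      ∑ i, ∑ k, (metropolisRate G i k : ℝ) * ((φ k - φ i) * ψ i) := by
    simp only [← Finset.sum_neg_distrib, ← Finset.sum_sub_distrib]
    exact Finset.sum_congr rfl fun i _ => Finset.sum_congr rfl fun k _ => by ring
  rw [h3, ← h1, ← h2]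
  ring

lemma sum_walkGenerator (φ : V → ℝ) : ∑ i, walkGenerator G φ i = 0 := by
  simpa using sum_mul_walkGenerator (G := G) φ (fun _ => 1)

lemma walkGenerator_sub_const (φ : V → ℝ) (c : ℝ) (i : V) :
    walkGenerator G (fun k => φ k - c) i = walkGenerator G φ i := by
  simp [walkGenerator]

/-- The Green function of the Metropolis walk relative to its uniform stationary law. -/
lemma exists_green [DecidableEq V] (hG : G.Connected) (a : V) :
    ∃ φ : V → ℝ, ∑ i, φ i = 0 ∧
      ∀ i, walkGenerator G φ i = 1 / Fintype.card V - if i = a then 1 else 0 := by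
  have hn : (0 : ℝ) < Fintype.card V := by
    exact_mod_cast Fintype.card_pos_iff.2 ⟨a⟩
  -- The generator kills constants; adding the total sum makes its negative invertible. If T φ = 0,
  -- summation gives ∑ φ = 0, so φ has zero energy, is constant, and vanishes. The Green function is
  -- the centred solution of T φ = δ_a.
  let T : (V → ℝ) →ₗ[ℝ] (V → ℝ) :=
    { toFun := fun φ i => ∑ k, φ k - walkGenerator G φ i
      map_add' := fun φ ψ => by
        ext i
        simp only [walkGenerator, Pi.add_apply]
        simp only [mul_add, mul_sub, Finset.sum_add_distrib, Finset.sum_sub_distrib]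
        ring
      map_smul' := fun c φ => by
        ext i
        simp only [walkGenerator, Pi.smul_apply, smul_eq_mul, RingHom.id_apply, mul_sub,
          Finset.mul_sum]
        congr 1
        exact Finset.sum_congr rfl fun _ _ => by ring }
  have hTapp : ∀ φ i, T φ i = ∑ k, φ k - walkGenerator G φ i := fun _ _ => rfl
  have hsum : ∀ φ, ∑ i, T φ i = Fintype.card V * ∑ k, φ k := fun φ => by
    simp [hTapp, Finset.sum_sub_distrib, sum_walkGenerator]
  have hinj : Function.Injective T := by
    rw [injective_iff_map_eq_zero]
    intro φ hφ
    have h0 : ∑ k, φ k = 0 := by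
      have := hsum φ
      rw [hφ] at this
      simpa [hn.ne'] using this.symm
    have hL : ∀ i, walkGenerator G φ i = 0 := fun i => by
      have := hTapp φ i
      rw [hφ, h0] at this
      simpa using this.symm
    have hE := sum_mul_walkGenerator (G := G) φ φ
    simp only [hL, mul_zero, Finset.sum_const_zero] at hE
    have hconst : ∀ b, φ b = φ a := fun b => by
      have := sq_sub_le_energy hG φ b a
      have hE' : ∑ i, ∑ j, (metropolisRate G i j : ℝ) * (φ j - φ i) ^ 2 = 0 := by
        simp only [pow_two]
        linarith
      rw [hE', mul_zero] at this
      nlinarith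
    have : (Fintype.card V : ℝ) * φ a = 0 := by
      rw [← h0, Finset.sum_congr rfl fun b _ => hconst b]
      simp
    ext b
    rw [hconst b]
    simpa [hn.ne'] using this
  obtain ⟨φ, hφ⟩ := (LinearMap.injective_iff_surjective.1 hinj) (Pi.single a 1)
  have hs : (Fintype.card V : ℝ) * ∑ k, φ k = 1 := by
    rw [← hsum, hφ]
    simp
  refine ⟨fun i => φ i - (∑ k, φ k) / Fintype.card V, ?_, fun i => ?_⟩
  · simp only [Finset.sum_sub_distrib, Finset.sum_const, Finset.card_univ, nsmul_eq_mul]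
    field_simp
    ring
  · rw [walkGenerator_sub_const]
    have := hTapp φ i
    rw [hφ, Pi.single_apply] at this
    have h' : ∑ k, φ k = 1 / Fintype.card V := by field_simp; linarith
    linarith

/-- A function on pairs of vertices, with values between `1` and `2`, which the pair of walks
contracts at rate of order `1 / n ^ 2` away from the diagonal. -/
lemma exists_pair_function (hG : G.Connected) :
    ∃ w : V → V → ℝ, (∀ a b, 1 ≤ w a b ∧ w a b ≤ 2) ∧ ∀ a b, a ≠ b →
      walkGenerator G (fun k => w k b) a + walkGenerator G (w a) b ≤
        -(1 / (48 * (Fintype.card V : ℝ) ^ 2)) * w a b := by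
  classical
  choose Z hZ0 hZ using exists_green hG
  have hn : (0 : ℝ) < Fintype.card V := by
    have := hG.nonempty
    exact_mod_cast Fintype.card_pos
  have hpair : ∀ a b, Z a b = -∑ i, Z a i * walkGenerator G (Z b) i := fun a b => by
    simp only [hZ, mul_sub, Finset.sum_sub_distrib, ← Finset.sum_mul, hZ0]
    simp
  have hsymm : ∀ a b, Z a b = Z b a := fun a b => by
    rw [hpair, hpair b a, sum_mul_walkGenerator, sum_mul_walkGenerator]
    simp only [mul_comm]
  -- 12 = 6 · 2: the energy of Z a over ordered pairs is 2 Z a a.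
  set ρ : ℝ := 12 * Fintype.card V with hρ
  have hρ0 : 0 < ρ := by positivity
  have hvar : ∀ a b, (Z a a - Z a b) ^ 2 ≤ ρ * Z a a := fun a b => by
    have h1 := sq_sub_le_energy hG (Z a) a b
    have h2 := hpair a a
    rw [sum_mul_walkGenerator] at h2
    simp only [← pow_two] at h2
    calc _ ≤ _ := h1
      _ = _ := by rw [h2, hρ]; ring
  have hnonneg : ∀ a, 0 ≤ Z a a := fun a => by
    have := (sq_nonneg _).trans (hvar a a)
    exact nonneg_of_mul_nonneg_right this hρ0
  -- If Z a a exceeded ρ, `hvar` would force Z a b > 0 for every b, against the zero sum of Z a.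
  have hdiag : ∀ a, Z a a ≤ ρ := fun a => by
    by_contra! h
    have hlt : ∀ b, 0 < Z a b := fun b => by
      have := hvar a b
      by_contra! hb
      nlinarith
    have := Finset.sum_pos (fun b _ => hlt b) ⟨a, Finset.mem_univ a⟩
    rw [hZ0] at this
    exact lt_irrefl _ this
  have hdiff : ∀ a b, |Z a a - Z a b| ≤ ρ := fun a b => by
    refine abs_le_of_sq_le_sq ?_ hρ0.le
    nlinarith [hvar a b, hdiag a]
  have habs : ∀ a b, -(2 * ρ) ≤ Z a b ∧ Z a b ≤ 2 * ρ := fun a b => by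
    have := abs_le.1 (hdiff a b)
    constructor <;> linarith [hnonneg a, hdiag a]
  -- This affine map sends [-2ρ, 2ρ] to [1, 2]. Off the diagonal each coordinate contributes -1 /
  -- (4ρn) = -1 / (48n²), and w ≤ 2 turns the sum of both into a multiple of w.
  refine ⟨fun a b => (6 * ρ - Z a b) / (4 * ρ), fun a b => ⟨?_, ?_⟩, fun a b hab => ?_⟩
  · rw [le_div_iff₀ (by positivity)]
    linarith [habs a b]
  · rw [div_le_iff₀ (by positivity)]
    linarith [habs a b]
  · have hscale : ∀ (φ : V → ℝ) i, walkGenerator G (fun k => (6 * ρ - φ k) / (4 * ρ)) i =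
        -(1 / (4 * ρ)) * walkGenerator G φ i := fun φ i => by
      simp only [walkGenerator, Finset.mul_sum]
      exact Finset.sum_congr rfl fun _ _ => by field_simp; ring
    have e1 : walkGenerator G (fun k => (6 * ρ - Z k b) / (4 * ρ)) a =
        -(1 / (4 * ρ)) * (1 / Fintype.card V) := by
      simp only [fun k => hsymm k b, hscale, hZ, if_neg hab, sub_zero]
    have e2 : walkGenerator G (fun k => (6 * ρ - Z a k) / (4 * ρ)) b =
        -(1 / (4 * ρ)) * (1 / Fintype.card V) := by
      simp only [hscale, hZ, if_neg hab.symm, sub_zero]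
    rw [e1, e2]
    have hw : (6 * ρ - Z a b) / (4 * ρ) ≤ 2 := by
      rw [div_le_iff₀ (by positivity)]
      linarith [habs a b]
    calc _ = -(1 / (48 * (Fintype.card V : ℝ) ^ 2)) * 2 := by rw [hρ]; field_simp; ring
      _ ≤ _ := mul_le_mul_of_nonpos_left hw (by
        rw [neg_nonpos]; positivity)

end Green

/-! ### A single update compared with an exchange of its endpoints -/

section Update

variable {V : Type*} [DecidableEq V]

lemma quantizedUpdate_le {i j : V} {x : V → ℤ} {M : ℤ} (hx : ∀ k, x k ≤ M) (k : V) :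
    quantizedUpdate i j x k ≤ M := by
  have := hx i; have := hx j; have := hx k
  unfold quantizedUpdate moveToward
  split_ifs <;> omega

lemma le_quantizedUpdate {i j : V} {x : V → ℤ} {m : ℤ} (hx : ∀ k, m ≤ x k) (k : V) :
    m ≤ quantizedUpdate i j x k := by
  have := hx i; have := hx j; have := hx k
  unfold quantizedUpdate moveToward
  split_ifs <;> omega

lemma quantizedUpdate_comm {i j : V} (x : V → ℤ) :
    quantizedUpdate i j x = quantizedUpdate j i x := by
  ext k
  unfold quantizedUpdate
  split_ifs with h1 h2 <;> simp_all

lemma sum_quantizedUpdate [Fintype V] {i j : V} (hij : i ≠ j) (x : V → ℤ) :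
    ∑ k, quantizedUpdate i j x k = ∑ k, x k := by
  have h : ∀ k, quantizedUpdate i j x k = x k + ((if k = i then moveToward (x i) (x j) - x i else 0)
      + if k = j then moveToward (x j) (x i) - x j else 0) := fun k => by
    unfold quantizedUpdate
    split_ifs with h1 h2 <;> simp_all
  simp only [h, Finset.sum_add_distrib, Finset.sum_ite_eq', Finset.mem_univ, if_true]
  unfold moveToward
  split_ifs <;> omega

/-- A minimal value at `k` after an update along `{i, j}` comes from the swapped node. -/
lemma eq_of_quantizedUpdate_eq_min {i j : V} {x : V → ℤ} {m : ℤ} (hx : ∀ k, m ≤ x k) {k : V}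
    (h : quantizedUpdate i j x k = m) : x (Equiv.swap i j k) = m := by
  have := hx i; have := hx j
  unfold quantizedUpdate moveToward at h
  rw [Equiv.swap_apply_def]
  split_ifs at h ⊢ <;> omega

lemma eq_of_quantizedUpdate_eq_max {i j : V} {x : V → ℤ} {M : ℤ} (hx : ∀ k, x k ≤ M) {k : V}
    (h : quantizedUpdate i j x k = M) : x (Equiv.swap i j k) = M := by
  have := hx i; have := hx j
  unfold quantizedUpdate moveToward at h
  rw [Equiv.swap_apply_def]
  split_ifs at h ⊢ <;> omega

/-- The image of the pair function `w` under an exchange along `{i, j}`, killed when the pair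
sits on `{i, j}`. -/
def exchangePair (w : V → V → ℝ) (i j a b : V) : ℝ :=
  if (a = i ∧ b = j) ∨ (a = j ∧ b = i) then 0 else w (Equiv.swap i j a) (Equiv.swap i j b)

/-- If the edge meets the pair in at most one node, both sides agree. If the pair sits on the edge,
independent walkers would move to (b, b) or (a, a), and the claim becomes w a b ≤ w a a + w b b.
This is why w has to take values in [1, 2]. -/
lemma exchangePair_sub_le {w : V → V → ℝ} (hw : ∀ a b, 1 ≤ w a b ∧ w a b ≤ 2) {i j a b : V}
    (hij : i ≠ j) (hab : a ≠ b) :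
    exchangePair w i j a b - w a b ≤
      (if i = a then w j b - w a b else 0) + (if j = a then w i b - w a b else 0) +
      ((if i = b then w a j - w a b else 0) + (if j = b then w a i - w a b else 0)) := by
  have h1 := hw a b; have h2 := hw b b; have h3 := hw a a; have h4 := hw b a
  unfold exchangePair
  by_cases hia : i = a
  · subst hia
    by_cases hjb : j = b
    · subst hjb
      simp [hij, hij.symm]
      linarith
    · have : b ≠ j := Ne.symm hjb
      simp [hij.symm, hjb, hab, this, hab.symm, Equiv.swap_apply_of_ne_of_ne]
  · by_cases hja : j = a
    · subst hja
      by_cases hib : i = b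
      · subst hib
        simp [hij, hij.symm]
        linarith
      · have : b ≠ i := Ne.symm hib
        simp [hia, hib, hab, this, hab.symm, Equiv.swap_apply_of_ne_of_ne]
    · have hia' : a ≠ i := Ne.symm hia
      have hja' : a ≠ j := Ne.symm hja
      rw [Equiv.swap_apply_of_ne_of_ne hia' hja']
      by_cases hib : i = b
      · subst hib
        simp [hia, hja, hia', hja', hij.symm]
      · by_cases hjb : j = b
        · subst hjb
          simp [hia, hja, hia', hja', hij]
        · have hib' : b ≠ i := Ne.symm hib
          have hjb' : b ≠ j := Ne.symm hjb
          simp [hia, hja, hia', hja', hib, hjb, Equiv.swap_apply_of_ne_of_ne hib' hjb']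

end Update

/-! ### Drift of the Lyapunov function -/

section Drift

lemma sum_sum_comm {ι κ : Type*} [Fintype ι] [Fintype κ] (F : ι → ι → κ → κ → ℝ) :
    ∑ i, ∑ j, ∑ a, ∑ b, F i j a b = ∑ a, ∑ b, ∑ i, ∑ j, F i j a b := by
  calc _ = ∑ i, ∑ a, ∑ j, ∑ b, F i j a b := Finset.sum_congr rfl fun i _ => Finset.sum_comm
    _ = ∑ a, ∑ i, ∑ b, ∑ j, F i j a b := by
      rw [Finset.sum_comm]
      exact Finset.sum_congr rfl fun a _ => Finset.sum_congr rfl fun i _ => Finset.sum_comm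
    _ = _ := Finset.sum_congr rfl fun a _ => Finset.sum_comm


variable {V : Type*} [Fintype V]

/-- The sum of the pair function `w` over the nodes with values `m` and `M`. -/
def pairSum (w : V → V → ℝ) (m M : ℤ) (x : V → ℤ) : ℝ :=
  ∑ a, ∑ b, if x a = m ∧ x b = M then w a b else 0

lemma pairSum_nonneg {w : V → V → ℝ} (hw : ∀ a b, 1 ≤ w a b ∧ w a b ≤ 2) (m M : ℤ)
    (x : V → ℤ) : 0 ≤ pairSum w m M x :=
  Finset.sum_nonneg fun a _ => Finset.sum_nonneg fun b _ => by
    have := hw a b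
    split_ifs <;> linarith

lemma pairSum_le {w : V → V → ℝ} (hw : ∀ a b, 1 ≤ w a b ∧ w a b ≤ 2) (m M : ℤ)
    (x : V → ℤ) : pairSum w m M x ≤ 2 * (Fintype.card V : ℝ) ^ 2 := by
  calc _ ≤ ∑ a : V, ∑ b : V, (2 : ℝ) := Finset.sum_le_sum fun a _ => Finset.sum_le_sum fun b _ => by
        have := hw a b
        split_ifs <;> linarith
    _ = _ := by simp; ring

lemma one_le_pairSum {w : V → V → ℝ} (hw : ∀ a b, 1 ≤ w a b ∧ w a b ≤ 2) {x : V → ℤ} (a b : V) :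
    1 ≤ pairSum w (x a) (x b) x := by
  have h0 : ∀ c d, 0 ≤ if x c = x a ∧ x d = x b then w c d else 0 := fun c d => by
    have := hw c d
    split_ifs <;> linarith
  calc 1 ≤ w a b := (hw a b).1
    _ = if x a = x a ∧ x b = x b then w a b else 0 := by simp
    _ ≤ ∑ d, if x a = x a ∧ x d = x b then w a d else 0 :=
      Finset.single_le_sum (f := fun d => if x a = x a ∧ x d = x b then w a d else 0)
        (fun d _ => h0 a d) (Finset.mem_univ b)
    _ ≤ _ := Finset.single_le_sum (f := fun c => ∑ d, if x c = x a ∧ x d = x b then w c d else 0)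
        (fun c _ => Finset.sum_nonneg fun d _ => h0 c d) (Finset.mem_univ a)

/-- The smallest value of a configuration. -/
def minValue [Nonempty V] (x : V → ℤ) : ℤ := Finset.univ.inf' Finset.univ_nonempty x

/-- The largest value of a configuration. -/
def maxValue [Nonempty V] (x : V → ℤ) : ℤ := Finset.univ.sup' Finset.univ_nonempty x

lemma minValue_le [Nonempty V] (x : V → ℤ) (k : V) : minValue x ≤ x k :=
  Finset.inf'_le _ (Finset.mem_univ k)

lemma le_maxValue [Nonempty V] (x : V → ℤ) (k : V) : x k ≤ maxValue x :=
  Finset.le_sup' _ (Finset.mem_univ k)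

lemma exists_eq_minValue [Nonempty V] (x : V → ℤ) : ∃ a, x a = minValue x := by
  obtain ⟨a, _, ha⟩ := Finset.exists_mem_eq_inf' (Finset.univ_nonempty (α := V)) x
  exact ⟨a, ha.symm⟩

lemma exists_eq_maxValue [Nonempty V] (x : V → ℤ) : ∃ a, x a = maxValue x := by
  obtain ⟨a, _, ha⟩ := Finset.exists_mem_eq_sup' (Finset.univ_nonempty (α := V)) x
  exact ⟨a, ha.symm⟩

/-- The Lyapunov function built from a pair function `w`; a unit of spread above `2` costs `Γ`. -/
noncomputable def lyapunov [Nonempty V] (w : V → V → ℝ) (Γ : ℝ) (x : V → ℤ) : ℝ :=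
  if maxValue x - minValue x ≤ 1 then 0
  else Real.log (1 + pairSum w (minValue x) (maxValue x) x) +
    ((maxValue x - minValue x - 2 : ℤ) : ℝ) * Γ

lemma log_one_add_pairSum_le {w : V → V → ℝ} (hw : ∀ a b, 1 ≤ w a b ∧ w a b ≤ 2) (m M : ℤ)
    (x : V → ℤ) :
    0 ≤ Real.log (1 + pairSum w m M x) ∧
      Real.log (1 + pairSum w m M x) ≤ Real.log (1 + 2 * (Fintype.card V : ℝ) ^ 2) := by
  have h0 := pairSum_nonneg hw m M x
  have h1 := pairSum_le hw m M x
  exact ⟨Real.log_nonneg (by linarith), Real.log_le_log (by linarith) (by linarith)⟩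

lemma log_card_nonneg : 0 ≤ Real.log (1 + 2 * (Fintype.card V : ℝ) ^ 2) :=
  Real.log_nonneg (by nlinarith [sq_nonneg (Fintype.card V : ℝ)])

lemma lyapunov_nonneg [Nonempty V] {w : V → V → ℝ} (hw : ∀ a b, 1 ≤ w a b ∧ w a b ≤ 2)
    (x : V → ℤ) : 0 ≤ lyapunov w (Real.log (1 + 2 * (Fintype.card V : ℝ) ^ 2)) x := by
  unfold lyapunov
  split_ifs with h
  · rfl
  · have h2 : (0 : ℝ) ≤ ((maxValue x - minValue x - 2 : ℤ) : ℝ) := by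
      exact_mod_cast (by omega : (0 : ℤ) ≤ maxValue x - minValue x - 2)
    have := (log_one_add_pairSum_le hw (minValue x) (maxValue x) x).1
    have := mul_nonneg h2 (log_card_nonneg (V := V))
    linarith

/-- The logarithm costs at most one more Γ, so a spread s ≥ 2 costs at most (s - 1) Γ. -/
lemma lyapunov_le_of_le [Nonempty V] {w : V → V → ℝ} (hw : ∀ a b, 1 ≤ w a b ∧ w a b ≤ 2)
    {x : V → ℤ} {m M : ℤ} (hmM : m + 1 ≤ M) (hx : ∀ k, m ≤ x k ∧ x k ≤ M) :
    lyapunov w (Real.log (1 + 2 * (Fintype.card V : ℝ) ^ 2)) x ≤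
      ((M - m - 1 : ℤ) : ℝ) * Real.log (1 + 2 * (Fintype.card V : ℝ) ^ 2) := by
  obtain ⟨a, ha⟩ := exists_eq_minValue x
  obtain ⟨b, hb⟩ := exists_eq_maxValue x
  have h1 := (hx a).1; have h2 := (hx b).2
  unfold lyapunov
  split_ifs with h
  · refine mul_nonneg ?_ (log_card_nonneg (V := V))
    exact_mod_cast (by omega : (0 : ℤ) ≤ M - m - 1)
  · have h3 := (log_one_add_pairSum_le hw (minValue x) (maxValue x) x).2
    have h4 : ((maxValue x - minValue x - 2 : ℤ) : ℝ) ≤ ((M - m - 1 : ℤ) : ℝ) - 1 := by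
      exact_mod_cast (by omega : maxValue x - minValue x - 2 ≤ M - m - 1 - 1)
    have := mul_le_mul_of_nonneg_right h4 (log_card_nonneg (V := V))
    linarith

/-- The Lyapunov function is bounded by the same expression with a larger range of values. -/
lemma lyapunov_le_extend [Nonempty V] {w : V → V → ℝ} (hw : ∀ a b, 1 ≤ w a b ∧ w a b ≤ 2)
    {x : V → ℤ} {m M : ℤ} (hmM : m + 2 ≤ M) (hx : ∀ k, m ≤ x k ∧ x k ≤ M) :
    lyapunov w (Real.log (1 + 2 * (Fintype.card V : ℝ) ^ 2)) x ≤
      Real.log (1 + pairSum w m M x) +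
        ((M - m - 2 : ℤ) : ℝ) * Real.log (1 + 2 * (Fintype.card V : ℝ) ^ 2) := by
  obtain ⟨a, ha⟩ := exists_eq_minValue x
  obtain ⟨b, hb⟩ := exists_eq_maxValue x
  have h1 := (hx a).1; have h2 := (hx b).2
  by_cases h : minValue x = m ∧ maxValue x = M
  · unfold lyapunov
    rw [h.1, h.2, if_neg (by omega)]
  · have h3 := (log_one_add_pairSum_le hw m M x).1
    -- The spread is strictly below M - m here, so the charge for one lost unit covers the new
    -- logarithm. The maximum with `minValue x + 1` takes care of constant configurations.
    have h4 := lyapunov_le_of_le hw (m := minValue x) (M := max (minValue x + 1) (maxValue x))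
      (le_max_left _ _) fun k => ⟨minValue_le x k, (le_maxValue x k).trans (le_max_right _ _)⟩
    have h5 : ((max (minValue x + 1) (maxValue x) - minValue x - 1 : ℤ) : ℝ) ≤
        ((M - m - 2 : ℤ) : ℝ) := by
      exact_mod_cast (by omega)
    have := mul_le_mul_of_nonneg_right h5 (log_card_nonneg (V := V))
    linarith

/-- A configuration with spread at most one and the right sum is in the consensus set. -/
lemma mem_consensusSet [Nonempty V] {x₀ x : V → ℤ} (hsum : ∑ i, x i = ∑ i, x₀ i)
    (hx : maxValue x - minValue x ≤ 1) : x ∈ consensusSet x₀ := by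
  have havg : average x = average x₀ := by
    unfold average
    congr 1
    exact_mod_cast hsum
  have hn : (0 : ℚ) < Fintype.card V := by exact_mod_cast Fintype.card_pos
  refine ⟨fun i => ?_, havg⟩
  rw [← havg]
  have hlo : (minValue x : ℚ) ≤ average x := by
    rw [average, le_div_iff₀ hn]
    calc (minValue x : ℚ) * Fintype.card V = ∑ _i : V, (minValue x : ℚ) := by simp [mul_comm]
      _ ≤ _ := Finset.sum_le_sum fun i _ => by exact_mod_cast minValue_le x i
  have hlt : average x < minValue x + 1 ∨ ∀ i, x i = minValue x + 1 := by
    by_cases h : ∀ i, x i = minValue x + 1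
    · exact Or.inr h
    · left
      push Not at h
      obtain ⟨j, hj⟩ := h
      rw [average, div_lt_iff₀ hn]
      calc _ < ∑ _i : V, ((minValue x : ℚ) + 1) := by
            refine Finset.sum_lt_sum (fun i _ => ?_) ⟨j, Finset.mem_univ j, ?_⟩
            · have := le_maxValue x i
              exact_mod_cast (by omega : x i ≤ minValue x + 1)
            · have := le_maxValue x j
              exact_mod_cast (by omega : x j < minValue x + 1)
        _ = _ := by simp; ring
  have hlt' : average x < minValue x + 1 := by
    refine hlt.resolve_right fun h => ?_
    obtain ⟨a, ha⟩ := exists_eq_minValue x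
    have := h a
    omega
  have hfl : ⌊average x⌋ = minValue x := by
    rw [Int.floor_eq_iff]
    exact ⟨hlo, hlt'⟩
  rw [hfl]
  have := minValue_le x i
  have := le_maxValue x i
  omega

variable [DecidableEq V] {G : SimpleGraph V} [DecidableRel G.Adj]

/-- The generator of the quantized Metropolis dynamics. -/
noncomputable def configGenerator (G : SimpleGraph V) [DecidableRel G.Adj] (f : (V → ℤ) → ℝ)
    (x : V → ℤ) : ℝ :=
  1 / 2 * ∑ i, ∑ j, (metropolisRate G i j : ℝ) * (f (quantizedUpdate i j x) - f x)

/-- After reindexing by the exchange, every extreme pair of the new configuration comes from an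
extreme pair of the old one. A pair sitting on {i, j} does not survive because its values become m +
1 and M - 1; for M = m + 1 the values would merely swap, hence the hypothesis on the spread. -/
lemma pairSum_quantizedUpdate_le {w : V → V → ℝ} (hw : ∀ a b, 1 ≤ w a b ∧ w a b ≤ 2) {m M : ℤ}
    (hmM : m + 2 ≤ M) {x : V → ℤ} (hm : ∀ k, m ≤ x k) (hM : ∀ k, x k ≤ M) (i j : V) :
    pairSum w m M (quantizedUpdate i j x) ≤
      ∑ a, ∑ b, if x a = m ∧ x b = M then exchangePair w i j a b else 0 := by
  rw [← Equiv.sum_comp (Equiv.swap i j)]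
  unfold pairSum
  refine Finset.sum_le_sum fun a _ => ?_
  rw [← Equiv.sum_comp (Equiv.swap i j) (fun b => if x (Equiv.swap i j a) = m ∧ x b = M then
    exchangePair w i j (Equiv.swap i j a) b else 0)]
  refine Finset.sum_le_sum fun b _ => ?_
  have hnn : 0 ≤ exchangePair w i j (Equiv.swap i j a) (Equiv.swap i j b) := by
    unfold exchangePair
    split_ifs
    · rfl
    · linarith [(hw (Equiv.swap i j (Equiv.swap i j a)) (Equiv.swap i j (Equiv.swap i j b))).1]
  by_cases h : quantizedUpdate i j x a = m ∧ quantizedUpdate i j x b = M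
  · have ha := eq_of_quantizedUpdate_eq_min hm h.1
    have hb := eq_of_quantizedUpdate_eq_max hM h.2
    rw [if_pos h, if_pos ⟨ha, hb⟩, exchangePair, if_neg, Equiv.swap_apply_self,
      Equiv.swap_apply_self]
    rintro (⟨h1, h2⟩ | ⟨h1, h2⟩)
    · rw [h1] at ha
      rw [h2] at hb
      rw [Equiv.swap_apply_eq_iff, Equiv.swap_apply_left] at h1
      have h3 := h.1
      unfold quantizedUpdate moveToward at h3
      subst h1
      split_ifs at h3 <;> omega
    · rw [h1] at ha
      rw [h2] at hb
      rw [Equiv.swap_apply_eq_iff, Equiv.swap_apply_right] at h1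
      have h3 := h.1
      unfold quantizedUpdate moveToward at h3
      subst h1
      simp only [if_true] at h3
      split_ifs at h3 <;> omega
  · rw [if_neg h]
    split_ifs
    · exact hnn
    · rfl

/-- Each of the two walk generators arises twice, from i and from j, which absorbs the factor 1 / 2.
-/
lemma sum_rate_exchangePair_le {w : V → V → ℝ} (hw : ∀ a b, 1 ≤ w a b ∧ w a b ≤ 2) {a b : V}
    (hab : a ≠ b) :
    1 / 2 * ∑ i, ∑ j, (metropolisRate G i j : ℝ) * (exchangePair w i j a b - w a b) ≤
      walkGenerator G (fun k => w k b) a + walkGenerator G (w a) b := by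
  have key : ∀ i j, (metropolisRate G i j : ℝ) * (exchangePair w i j a b - w a b) ≤
      ((if i = a then (metropolisRate G a j : ℝ) * (w j b - w a b) else 0) +
        (if j = a then (metropolisRate G a i : ℝ) * (w i b - w a b) else 0)) +
      ((if i = b then (metropolisRate G b j : ℝ) * (w a j - w a b) else 0) +
        (if j = b then (metropolisRate G b i : ℝ) * (w a i - w a b) else 0)) := by
    intro i j
    by_cases hij : i = j
    · subst hij
      rw [metropolisRate_self]
      split_ifs with h1 h2 h2
      · exact absurd (h1.symm.trans h2) hab
      · subst h1; simp
      · subst h2; simp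
      · simp
    · refine (mul_le_mul_of_nonneg_left (exchangePair_sub_le hw hij hab)
        (NNReal.coe_nonneg _)).trans (le_of_eq ?_)
      simp only [mul_add, mul_ite, mul_zero]
      congr 2
      · split_ifs with h
        · rw [h]
        · rfl
      · split_ifs with h
        · rw [h, metropolisRate_comm]
        · rfl
      · split_ifs with h
        · rw [h]
        · rfl
      · split_ifs with h
        · rw [h, metropolisRate_comm]
        · rfl
  calc _ ≤ 1 / 2 * ∑ i, ∑ j, _ := mul_le_mul_of_nonneg_left
        (Finset.sum_le_sum fun i _ => Finset.sum_le_sum fun j _ => key i j) (by norm_num)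
    _ = _ := by
      simp only [Finset.sum_add_distrib, Finset.sum_ite_eq', Finset.mem_univ, if_true]
      rw [Finset.sum_comm (f := fun i j => if i = a then _ else _),
        Finset.sum_comm (f := fun i j => if i = b then _ else _)]
      simp only [Finset.sum_ite_eq', Finset.mem_univ, if_true, walkGenerator]
      ring

lemma configGenerator_pairSum_le {w : V → V → ℝ} (hw : ∀ a b, 1 ≤ w a b ∧ w a b ≤ 2) {lam : ℝ}
    (hlam : ∀ a b, a ≠ b →
      walkGenerator G (fun k => w k b) a + walkGenerator G (w a) b ≤ -lam * w a b)
    {m M : ℤ} (hmM : m + 2 ≤ M) {x : V → ℤ} (hm : ∀ k, m ≤ x k) (hM : ∀ k, x k ≤ M) :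
    configGenerator G (pairSum w m M) x ≤ -lam * pairSum w m M x := by
  calc configGenerator G (pairSum w m M) x
      ≤ 1 / 2 * ∑ i, ∑ j, (metropolisRate G i j : ℝ) * ∑ a, ∑ b,
          if x a = m ∧ x b = M then exchangePair w i j a b - w a b else 0 := by
        unfold configGenerator
        gcongr with i _ j _
        refine (sub_le_sub_right (pairSum_quantizedUpdate_le hw hmM hm hM i j) _).trans
          (le_of_eq ?_)
        simp only [pairSum, ← Finset.sum_sub_distrib]
        refine Finset.sum_congr rfl fun a _ => Finset.sum_congr rfl fun b _ => ?_
        split_ifs <;> simp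
    _ = ∑ a, ∑ b, if x a = m ∧ x b = M then 1 / 2 * ∑ i, ∑ j, (metropolisRate G i j : ℝ) *
          (exchangePair w i j a b - w a b) else 0 := by
        simp only [Finset.mul_sum]
        rw [sum_sum_comm]
        refine Finset.sum_congr rfl fun a _ => Finset.sum_congr rfl fun b _ => ?_
        split_ifs <;> simp
    _ ≤ ∑ a, ∑ b, if x a = m ∧ x b = M then -lam * w a b else 0 := by
        gcongr with a _ b _
        split_ifs with h
        · have hab : a ≠ b := fun hab => by subst hab; omega
          exact (sum_rate_exchangePair_le hw hab).trans (hlam a b hab)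
        · rfl
    _ = _ := by
        simp only [pairSum, Finset.mul_sum, mul_ite, mul_zero]

/-- By log u ≤ u - 1 the drift of log (1 + W) is at most 𝓛W / (1 + W) ≤ -λW / (1 + W), and W ≥ 1
makes this at most -λ / 2. `lyapunov_le_extend` allows m and M to be kept fixed even if the update
shrinks the range. -/
lemma configGenerator_lyapunov_le [Nonempty V] {w : V → V → ℝ}
    (hw : ∀ a b, 1 ≤ w a b ∧ w a b ≤ 2) {lam : ℝ} (hlam0 : 0 ≤ lam)
    (hlam : ∀ a b, a ≠ b →
      walkGenerator G (fun k => w k b) a + walkGenerator G (w a) b ≤ -lam * w a b) (x : V → ℤ) :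
    configGenerator G (lyapunov w (Real.log (1 + 2 * (Fintype.card V : ℝ) ^ 2))) x ≤
      if maxValue x - minValue x ≤ 1 then 0 else -(lam / 2) := by
  have hUm : ∀ i j k, minValue x ≤ quantizedUpdate i j x k :=
    fun i j k => le_quantizedUpdate (minValue_le x) k
  have hUM : ∀ i j k, quantizedUpdate i j x k ≤ maxValue x :=
    fun i j k => quantizedUpdate_le (le_maxValue x) k
  split_ifs with h
  · refine le_of_eq ?_
    have : ∀ i j, lyapunov w (Real.log (1 + 2 * (Fintype.card V : ℝ) ^ 2))
        (quantizedUpdate i j x) = 0 := fun i j => by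
      obtain ⟨a, ha⟩ := exists_eq_minValue (quantizedUpdate i j x)
      obtain ⟨b, hb⟩ := exists_eq_maxValue (quantizedUpdate i j x)
      have := hUm i j a; have := hUM i j b
      rw [lyapunov, if_pos (by omega)]
    simp only [configGenerator, this]
    simp [lyapunov, h]
  · push Not at h
    obtain ⟨a, ha⟩ := exists_eq_minValue x
    obtain ⟨b, hb⟩ := exists_eq_maxValue x
    set m := minValue x with hm
    set M := maxValue x with hM
    have hW0 := pairSum_nonneg hw m M x
    have hW1 : 1 ≤ pairSum w m M x := by
      have := one_le_pairSum hw (x := x) a b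
      rwa [ha, hb] at this
    have hstep : ∀ i j, lyapunov w (Real.log (1 + 2 * (Fintype.card V : ℝ) ^ 2))
        (quantizedUpdate i j x) - lyapunov w (Real.log (1 + 2 * (Fintype.card V : ℝ) ^ 2)) x ≤
        1 / (1 + pairSum w m M x) *
          (pairSum w m M (quantizedUpdate i j x) - pairSum w m M x) := fun i j => by
      have h1 := lyapunov_le_extend hw (m := m) (M := M) (by omega)
        fun k => ⟨hUm i j k, hUM i j k⟩
      have h2 : lyapunov w (Real.log (1 + 2 * (Fintype.card V : ℝ) ^ 2)) x =
          Real.log (1 + pairSum w m M x) +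
          ((M - m - 2 : ℤ) : ℝ) * Real.log (1 + 2 * (Fintype.card V : ℝ) ^ 2) := by
        rw [lyapunov, if_neg (by omega)]
      have hW' := pairSum_nonneg hw m M (quantizedUpdate i j x)
      have h3 := Real.log_le_sub_one_of_pos
        (x := (1 + pairSum w m M (quantizedUpdate i j x)) / (1 + pairSum w m M x))
        (by positivity)
      rw [Real.log_div (by positivity) (by positivity)] at h3
      have h4 : (1 + pairSum w m M (quantizedUpdate i j x)) / (1 + pairSum w m M x) - 1 =
          1 / (1 + pairSum w m M x) *
          (pairSum w m M (quantizedUpdate i j x) - pairSum w m M x) := by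
        field_simp
        ring
      linarith
    calc _ ≤ 1 / 2 * ∑ i, ∑ j, (metropolisRate G i j : ℝ) * (1 / (1 + pairSum w m M x) *
          (pairSum w m M (quantizedUpdate i j x) - pairSum w m M x)) := by
          unfold configGenerator
          gcongr with i _ j _
          exact hstep i j
      _ = 1 / (1 + pairSum w m M x) * configGenerator G (pairSum w m M) x := by
          simp only [configGenerator, Finset.mul_sum]
          exact Finset.sum_congr rfl fun _ _ => Finset.sum_congr rfl fun _ _ => by ring
      _ ≤ 1 / (1 + pairSum w m M x) * (-lam * pairSum w m M x) := by
          gcongr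
          exact configGenerator_pairSum_le hw hlam (by omega) (minValue_le x) (le_maxValue x)
      _ ≤ _ := by
          rw [one_div_mul_eq_div, div_le_iff₀ (by positivity)]
          nlinarith

/-- A Lyapunov function for the quantized Metropolis dynamics, of order `(L - l) n ^ 2 log n`. -/
theorem exists_lyapunov (hG : G.Connected) :
    ∃ Φ : (V → ℤ) → ℝ, (∀ x, 0 ≤ Φ x) ∧
      (∀ (l L : ℤ) x, l < L → (∀ i : V, l ≤ x i ∧ x i ≤ L) → Φ x ≤
        96 * ((L : ℝ) - l) * (Fintype.card V : ℝ) ^ 2 *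
          Real.log (1 + 2 * (Fintype.card V : ℝ) ^ 2)) ∧
      ∀ x₀ x : V → ℤ, ∑ i, x i = ∑ i, x₀ i →
        configGenerator G Φ x ≤ -(consensusSet x₀)ᶜ.indicator 1 x := by
  have := hG.nonempty
  obtain ⟨w, hw, hlam⟩ := exists_pair_function hG
  have hn : (0 : ℝ) < Fintype.card V := by exact_mod_cast Fintype.card_pos
  refine ⟨fun x => 96 * (Fintype.card V : ℝ) ^ 2 *
    lyapunov w (Real.log (1 + 2 * (Fintype.card V : ℝ) ^ 2)) x,
    fun x => mul_nonneg (by positivity) (lyapunov_nonneg hw x), fun l L x hlL hx => ?_,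
    fun x₀ x hsum => ?_⟩
  · have h1 := lyapunov_le_of_le hw (Int.add_one_le_iff.2 hlL) hx
    have h2 := log_card_nonneg (V := V)
    have h3 : 0 ≤ 96 * (Fintype.card V : ℝ) ^ 2 := by positivity
    push_cast at h1
    nlinarith [mul_le_mul_of_nonneg_left h1 h3, mul_nonneg h3 h2]
  · have h1 := configGenerator_lyapunov_le hw (by positivity) hlam x
    have h2 : configGenerator G (fun x => 96 * (Fintype.card V : ℝ) ^ 2 *
        lyapunov w (Real.log (1 + 2 * (Fintype.card V : ℝ) ^ 2)) x) x =
        96 * (Fintype.card V : ℝ) ^ 2 *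
        configGenerator G (lyapunov w (Real.log (1 + 2 * (Fintype.card V : ℝ) ^ 2))) x := by
      simp only [configGenerator, Finset.mul_sum]
      exact Finset.sum_congr rfl fun _ _ => Finset.sum_congr rfl fun _ _ => by ring
    rw [h2]
    have h3 := mul_le_mul_of_nonneg_left h1 (a := 96 * (Fintype.card V : ℝ) ^ 2) (by positivity)
    refine h3.trans ?_
    split_ifs with h
    · simp [mem_consensusSet hsum h]
    · have h4 : (consensusSet x₀)ᶜ.indicator (1 : (V → ℤ) → ℝ) x ≤ 1 :=
        Set.indicator_le_self' (fun _ _ => zero_le_one) x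
      have h5 : 96 * (Fintype.card V : ℝ) ^ 2 * -(1 / (48 * (Fintype.card V : ℝ) ^ 2) / 2) = -1 := by
        field_simp
        norm_num
      linarith

end Drift

/-! ### Updates indexed by edges, and the time-discretized chain -/

section Edges

variable {V : Type*} [DecidableEq V] {G : SimpleGraph V}

/-- The quantized update along an edge. -/
def edgeUpdate (e : G.edgeSet) (x : V → ℤ) : V → ℤ :=
  Sym2.lift ⟨fun i j => quantizedUpdate i j x, fun _ _ => quantizedUpdate_comm x⟩ e.1

/-- The Metropolis rate of an edge. -/
noncomputable def edgeRate [Fintype V] [DecidableRel G.Adj] (e : G.edgeSet) : ℝ≥0 :=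
  Sym2.lift ⟨metropolisRate G, metropolisRate_comm⟩ e.1

lemma edgeUpdate_le (e : G.edgeSet) {x : V → ℤ} {M : ℤ} (hx : ∀ k, x k ≤ M) (k : V) :
    edgeUpdate e x k ≤ M := by
  obtain ⟨⟨i, j⟩, h⟩ := e
  exact quantizedUpdate_le hx k

lemma le_edgeUpdate (e : G.edgeSet) {x : V → ℤ} {m : ℤ} (hx : ∀ k, m ≤ x k) (k : V) :
    m ≤ edgeUpdate e x k := by
  obtain ⟨⟨i, j⟩, h⟩ := e
  exact le_quantizedUpdate hx k

lemma sum_edgeUpdate [Fintype V] (e : G.edgeSet) (x : V → ℤ) :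
    ∑ k, edgeUpdate e x k = ∑ k, x k := by
  obtain ⟨⟨i, j⟩, h⟩ := e
  exact sum_quantizedUpdate (G.ne_of_adj h) x

lemma single_one_injective {e e' : G.edgeSet}
    (h : (Pi.single e 1 : G.edgeSet → ℕ) = Pi.single e' 1) : e = e' := by
  by_contra hne
  have := congrFun h e
  simp [hne] at this

variable [Fintype V] [DecidableRel G.Adj]

lemma configGenerator_eq_sum_edges (f : (V → ℤ) → ℝ) (x : V → ℤ) :
    configGenerator G f x = ∑ e : G.edgeSet, (edgeRate e : ℝ) * (f (edgeUpdate e x) - f x) := by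
  let H : Sym2 V → ℝ := Sym2.lift ⟨fun i j => (metropolisRate G i j : ℝ) *
    (f (quantizedUpdate i j x) - f x), fun i j => by
      simp only [metropolisRate_comm i j, quantizedUpdate_comm (i := i) (j := j)]⟩
  have h1 : ∑ e : G.edgeSet, (edgeRate e : ℝ) * (f (edgeUpdate e x) - f x) =
      ∑ e ∈ Finset.univ.filter (· ∈ G.edgeSet), H e := by
    rw [Finset.sum_subtype (p := (· ∈ G.edgeSet)) _ (by simp)]
    refine Finset.sum_congr rfl fun e _ => ?_
    obtain ⟨⟨i, j⟩, h⟩ := e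
    rfl
  have h2 : ∑ i, ∑ j, (metropolisRate G i j : ℝ) * (f (quantizedUpdate i j x) - f x) =
      ∑ e : Sym2 V, ∑ p ∈ Finset.univ.filter (fun p : V × V => s(p.1, p.2) = e), H e := by
    rw [← Fintype.sum_prod_type', ← Finset.sum_fiberwise (g := fun p : V × V => s(p.1, p.2))]
    refine Finset.sum_congr rfl fun e _ => Finset.sum_congr rfl fun p hp => ?_
    rw [← (Finset.mem_filter.1 hp).2]
    rfl
  rw [h1, configGenerator, h2, Finset.sum_filter, Finset.mul_sum]
  refine Finset.sum_congr rfl fun e _ => ?_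
  induction e with
  | h a b =>
    split_ifs with hab
    · have hne : a ≠ b := G.ne_of_adj hab
      have : Finset.univ.filter (fun p : V × V => s(p.1, p.2) = s(a, b)) = {(a, b), (b, a)} := by
        ext ⟨p, q⟩
        simp
      rw [this, Finset.sum_pair (by simp [hne])]
      ring
    · have : H s(a, b) = 0 := by
        have : ¬ G.Adj a b := hab
        simp [H, metropolisRate, this]
      simp [this]

open Classical in
/-- The update prescribed by the arrival counts `ν` of a short time interval: the update of the
edge with an arrival if there is exactly one arrival, and none otherwise. -/
noncomputable def countUpdate (ν : G.edgeSet → ℕ) (x : V → ℤ) : V → ℤ :=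
  if h : ∃ e, ν = Pi.single e 1 then edgeUpdate h.choose x else x

lemma countUpdate_single (e : G.edgeSet) (x : V → ℤ) :
    countUpdate (Pi.single e 1) x = edgeUpdate e x := by
  have h : ∃ e', (Pi.single e 1 : G.edgeSet → ℕ) = Pi.single e' 1 := ⟨e, rfl⟩
  rw [countUpdate, dif_pos h, ← single_one_injective h.choose_spec]

lemma countUpdate_of_ne {ν : G.edgeSet → ℕ} (h : ∀ e, ν ≠ Pi.single e 1) (x : V → ℤ) :
    countUpdate ν x = x := by
  rw [countUpdate, dif_neg (by simpa using h)]

/-- Being linear in the indicators of single arrivals, this form lets independence factor the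
expectation edge by edge. -/
lemma apply_countUpdate (f : (V → ℤ) → ℝ) (ν : G.edgeSet → ℕ) (x : V → ℤ) :
    f (countUpdate ν x) = f x + ∑ e, ({Pi.single e 1} : Set (G.edgeSet → ℕ)).indicator 1 ν *
      (f (edgeUpdate e x) - f x) := by
  by_cases h : ∃ e, ν = Pi.single e 1
  · obtain ⟨e, rfl⟩ := h
    rw [Finset.sum_eq_single e]
    · simp [countUpdate_single]
    · intro e' _ hne
      rw [Set.indicator_of_notMem, zero_mul]
      exact fun h => hne (single_one_injective h).symm
    · simp
  · push Not at h
    rw [countUpdate_of_ne h, Finset.sum_eq_zero, add_zero]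
    intro e _
    rw [Set.indicator_of_notMem, zero_mul]
    exact h e

/-- The chain that performs one `countUpdate` per time interval. -/
noncomputable def countChain (x₀ : V → ℤ) (ν : ℕ → G.edgeSet → ℕ) : ℕ → V → ℤ
  | 0 => x₀
  | k + 1 => countUpdate (ν k) (countChain x₀ ν k)

lemma countChain_invariant {l L : ℤ} {x₀ : V → ℤ} (hx₀ : ∀ i, l ≤ x₀ i ∧ x₀ i ≤ L)
    (ν : ℕ → G.edgeSet → ℕ) (k : ℕ) :
    (∀ i, l ≤ countChain x₀ ν k i ∧ countChain x₀ ν k i ≤ L) ∧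
      ∑ i, countChain x₀ ν k i = ∑ i, x₀ i := by
  induction k with
  | zero => exact ⟨hx₀, rfl⟩
  | succ k ih =>
    rw [countChain]
    by_cases h : ∃ e, ν k = Pi.single e 1
    · obtain ⟨e, he⟩ := h
      rw [he, countUpdate_single, sum_edgeUpdate]
      exact ⟨fun i => ⟨le_edgeUpdate e (fun i => (ih.1 i).1) i,
        edgeUpdate_le e (fun i => (ih.1 i).2) i⟩, ih.2⟩
    · push Not at h
      rwa [countUpdate_of_ne h]

lemma countChain_congr (x₀ : V → ℤ) {ν ν' : ℕ → G.edgeSet → ℕ} {k : ℕ}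
    (h : ∀ j < k, ν j = ν' j) : countChain x₀ ν k = countChain x₀ ν' k := by
  induction k with
  | zero => rfl
  | succ k ih => rw [countChain, countChain, ih fun j hj => h j (by omega), h k (by omega)]

end Edges

/-! ### Occupation time of the discretized chain -/

section Chain

variable {V : Type*} [Fintype V] [DecidableEq V] {G : SimpleGraph V} [DecidableRel G.Adj]
  {Ω : Type*} [MeasurableSpace Ω] {P : Measure Ω} [IsProbabilityMeasure P]

lemma measurable_countChain {ξ : ℕ → Ω → G.edgeSet → ℕ} (hξ : ∀ k, Measurable (ξ k))
    (x₀ : V → ℤ) (k : ℕ) : Measurable fun ω => countChain x₀ (fun j => ξ j ω) k := by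
  induction k with
  | zero => exact measurable_const
  | succ k ih =>
    have : Measurable fun p : (G.edgeSet → ℕ) × (V → ℤ) => countUpdate p.1 p.2 :=
      Measurable.of_discrete
    exact this.comp ((hξ k).prodMk ih)

lemma integrable_comp_of_mem_Icc {Y : Ω → V → ℤ} (hY : Measurable Y) {l L : ℤ}
    (hmem : ∀ ω i, l ≤ Y ω i ∧ Y ω i ≤ L) (f : (V → ℤ) → ℝ) :
    Integrable (fun ω => f (Y ω)) P := by
  have hfin : (Set.Icc (fun _ : V => l) (fun _ => L)).Finite := Set.finite_Icc _ _
  obtain ⟨B, hB⟩ := (hfin.image fun x => ‖f x‖).bddAbove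
  refine Integrable.of_bound (C := B)
    ((Measurable.of_discrete (f := f)).comp hY).aestronglyMeasurable
    (Filter.Eventually.of_forall fun ω => hB ⟨Y ω, ⟨fun i => (hmem ω i).1, fun i => (hmem ω i).2⟩, rfl⟩)

/-- The one-step expectation of the chain is given by the generator. -/
lemma integral_countUpdate {Y : Ω → V → ℤ} {ζ : Ω → G.edgeSet → ℕ} (hY : Measurable Y)
    (hζ : Measurable ζ) (hind : IndepFun Y ζ P) {l L : ℤ}
    (hmem : ∀ ω i, l ≤ Y ω i ∧ Y ω i ≤ L) {q : ℝ}
    (hq : ∀ e, P.real (ζ ⁻¹' {Pi.single e 1}) = q * edgeRate e) (f : (V → ℤ) → ℝ) :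
    ∫ ω, f (countUpdate (ζ ω) (Y ω)) ∂P =
      ∫ ω, f (Y ω) ∂P + q * ∫ ω, configGenerator G f (Y ω) ∂P := by
  have hint := fun g => integrable_comp_of_mem_Icc (P := P) hY hmem g
  have hA : ∀ e : G.edgeSet, Measurable (({Pi.single e 1} : Set (G.edgeSet → ℕ)).indicator
    (1 : (G.edgeSet → ℕ) → ℝ)) := fun e => Measurable.of_discrete
  have hI : ∀ e : G.edgeSet, Integrable (fun ω =>
      ({Pi.single e 1} : Set (G.edgeSet → ℕ)).indicator (1 : (G.edgeSet → ℕ) → ℝ) (ζ ω)) P :=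
    fun e => Integrable.of_bound (C := 1) ((hA e).comp hζ).aestronglyMeasurable
      (Filter.Eventually.of_forall fun ω => by
        unfold Set.indicator
        split_ifs <;> simp)
  have hIn : ∀ e : G.edgeSet, IndepFun (fun ω =>
      ({Pi.single e 1} : Set (G.edgeSet → ℕ)).indicator (1 : (G.edgeSet → ℕ) → ℝ) (ζ ω))
      (fun ω => f (edgeUpdate e (Y ω)) - f (Y ω)) P := fun e =>
    hind.symm.comp (hA e) (Measurable.of_discrete (f := fun x => f (edgeUpdate e x) - f x))
  have hval : ∀ e : G.edgeSet, ∫ ω, ({Pi.single e 1} : Set (G.edgeSet → ℕ)).indicator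
      (1 : (G.edgeSet → ℕ) → ℝ) (ζ ω) ∂P = q * edgeRate e := fun e => by
    rw [← hq e, ← integral_indicator_one (hζ (measurableSet_singleton _))]
    rfl
  simp_rw [apply_countUpdate f]
  rw [integral_add (hint f), integral_finsetSum]
  · congr 1
    simp_rw [configGenerator_eq_sum_edges]
    rw [integral_finsetSum _ fun e _ =>
      hint fun x => (edgeRate e : ℝ) * (f (edgeUpdate e x) - f x), Finset.mul_sum]
    refine Finset.sum_congr rfl fun e _ => ?_
    rw [(hIn e).integral_fun_mul_eq_mul_integral (hI e).aestronglyMeasurable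
      (hint fun x => f (edgeUpdate e x) - f x).aestronglyMeasurable, hval, integral_const_mul,
      mul_assoc]
  · exact fun e _ => (hIn e).integrable_mul (hI e) (hint fun x => f (edgeUpdate e x) - f x)
  · exact integrable_finsetSum _ fun e _ =>
      (hIn e).integrable_mul (hI e) (hint fun x => f (edgeUpdate e x) - f x)

/-- A Lyapunov function bounds the expected occupation time of the chain outside of `C`. -/
lemma sum_measure_countChain_le {ξ : ℕ → Ω → G.edgeSet → ℕ} (hξ : ∀ k, Measurable (ξ k))
    {x₀ : V → ℤ} (hind : ∀ k, IndepFun (fun ω => countChain x₀ (fun j => ξ j ω) k) (ξ k) P)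
    {l L : ℤ} (hx₀ : ∀ i, l ≤ x₀ i ∧ x₀ i ≤ L) {q : ℝ} (hq0 : 0 ≤ q)
    (hq : ∀ k e, P.real (ξ k ⁻¹' {Pi.single e 1}) = q * edgeRate e) {Φ : (V → ℤ) → ℝ}
    (hΦ0 : ∀ x, 0 ≤ Φ x) {C : Set (V → ℤ)}
    (hΦ : ∀ x, ∑ i, x i = ∑ i, x₀ i → configGenerator G Φ x ≤ -Cᶜ.indicator 1 x) (m : ℕ) :
    q * ∑ k ∈ Finset.range m, P.real {ω | countChain x₀ (fun j => ξ j ω) k ∉ C} ≤ Φ x₀ := by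
  set Y : ℕ → Ω → V → ℤ := fun k ω => countChain x₀ (fun j => ξ j ω) k with hYdef
  have hY : ∀ k, Measurable (Y k) := measurable_countChain hξ x₀
  have hmem : ∀ k ω i, l ≤ Y k ω i ∧ Y k ω i ≤ L :=
    fun k ω => (countChain_invariant hx₀ (fun j => ξ j ω) k).1
  -- Discrete Dynkin formula: each step lowers the mean of Φ by at least q times the probability of
  -- being outside C.
  have key : ∀ m, ∫ ω, Φ (Y m ω) ∂P +
      q * ∑ k ∈ Finset.range m, P.real {ω | Y k ω ∉ C} ≤ Φ x₀ := by
    intro m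
    induction m with
    | zero => simp [hYdef, countChain]
    | succ k ih =>
      have h1 : ∫ ω, Φ (Y (k + 1) ω) ∂P =
          ∫ ω, Φ (Y k ω) ∂P + q * ∫ ω, configGenerator G Φ (Y k ω) ∂P :=
        integral_countUpdate (hY k) (hξ k) (hind k) (hmem k) (hq k) Φ
      have h2 : ∫ ω, configGenerator G Φ (Y k ω) ∂P ≤ -P.real {ω | Y k ω ∉ C} := by
        have hms : MeasurableSet {ω | Y k ω ∉ C} := hY k (MeasurableSet.of_discrete (s := Cᶜ))
        rw [← integral_indicator_one hms, ← integral_neg]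
        refine integral_mono (integrable_comp_of_mem_Icc (hY k) (hmem k) _)
          (((integrable_const (1 : ℝ)).indicator hms).neg) fun ω => ?_
        exact hΦ _ (countChain_invariant hx₀ (fun j => ξ j ω) k).2
      rw [Finset.sum_range_succ, h1, mul_add]
      nlinarith [mul_le_mul_of_nonneg_left h2 hq0]
  have h0 : 0 ≤ ∫ ω, Φ (Y m ω) ∂P := integral_nonneg fun ω => hΦ0 _
  linarith [key m]

end Chain

/-! ### Hitting times along grids -/

section HittingTime

/-- The first grid time, over all grids of mesh `1 / (d + 1)`, at which a path is in `C`. -/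
noncomputable def rationalHittingTime {S : Type*} (C : Set S) (x : ℝ≥0 → S) : ℝ≥0∞ :=
  open Classical in
  ⨅ p : ℕ × ℕ, if x ((p.1 : ℝ≥0) * (1 / ((p.2 : ℝ≥0) + 1))) ∈ C then
    (((p.1 : ℝ≥0) * (1 / ((p.2 : ℝ≥0) + 1)) : ℝ≥0) : ℝ≥0∞) else ⊤

/-- The grid version is a countable infimum, hence measurable, and suffices for an upper bound. -/
lemma hittingTime_le_rationalHittingTime {S : Type*} (C : Set S) (x : ℝ≥0 → S) :
    hittingTime C x ≤ rationalHittingTime C x := by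
  refine le_iInf fun p => ?_
  split_ifs with h
  · exact iInf₂_le (f := fun (t : ℝ≥0) (_ : x t ∈ C) => (t : ℝ≥0∞)) _ h
  · exact le_top

lemma measurable_rationalHittingTime {V Ω : Type*} [Fintype V] [MeasurableSpace Ω]
    {X : ℝ≥0 → Ω → V → ℤ} (hX : ∀ t, Measurable (X t)) (C : Set (V → ℤ)) :
    Measurable fun ω => rationalHittingTime C fun t => X t ω := by
  unfold rationalHittingTime
  refine Measurable.iInf fun p => ?_
  exact Measurable.ite (hX _ (MeasurableSet.of_discrete (s := C))) measurable_const
    measurable_const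

/-- On a grid, the truncated hitting time is at most the occupation time outside of `C`. -/
lemma min_rationalHittingTime_le {S : Type*} (C : Set S) (x : ℝ≥0 → S) (M d : ℕ) (y : ℕ → S)
    (B : ℕ → Prop) (hy : (∀ k < M * (d + 1), ¬ B k) →
      ∀ k ≤ M * (d + 1), x ((k : ℝ≥0) * (1 / ((d : ℝ≥0) + 1))) = y k) :
    open Classical in
    min (rationalHittingTime C x) M ≤ ENNReal.ofReal
      (1 / ((d : ℝ) + 1) * ∑ k ∈ Finset.range (M * (d + 1)), (if y k ∈ C then (0 : ℝ) else 1) +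
        M * ∑ k ∈ Finset.range (M * (d + 1)), (if B k then (1 : ℝ) else 0)) := by
  classical
  have h1 : 0 ≤ 1 / ((d : ℝ) + 1) *
      ∑ k ∈ Finset.range (M * (d + 1)), (if y k ∈ C then (0 : ℝ) else 1) :=
    mul_nonneg (by positivity) (Finset.sum_nonneg fun k _ => by split_ifs <;> norm_num)
  have h2 : 0 ≤ (M : ℝ) * ∑ k ∈ Finset.range (M * (d + 1)), (if B k then (1 : ℝ) else 0) :=
    mul_nonneg (by positivity) (Finset.sum_nonneg fun k _ => by split_ifs <;> norm_num)
  -- Without bad intervals, the first sum counts the steps before the chain enters C, or all M (d +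
  -- 1) of them. A single bad interval already contributes the truncation level M.
  by_cases hB : ∀ k < M * (d + 1), ¬ B k
  · by_cases hC : ∃ k, k < M * (d + 1) ∧ y k ∈ C
    · have hlt := (Nat.find_spec hC).1
      have hmem := (Nat.find_spec hC).2
      have hmin : ∀ j < Nat.find hC, y j ∉ C := fun j hj h =>
        Nat.find_min hC hj ⟨hj.trans hlt, h⟩
      set k := Nat.find hC
      refine (min_le_left _ _).trans ?_
      have hτ : rationalHittingTime C x ≤ (((k : ℝ≥0) * (1 / ((d : ℝ≥0) + 1)) : ℝ≥0) : ℝ≥0∞) := by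
        refine (iInf_le _ (k, d)).trans (le_of_eq ?_)
        rw [if_pos]
        rw [hy hB k hlt.le]
        exact hmem
      refine hτ.trans ?_
      rw [← ENNReal.ofReal_coe_nnreal]
      refine ENNReal.ofReal_le_ofReal ?_
      have h3 : (k : ℝ) ≤ ∑ k ∈ Finset.range (M * (d + 1)), (if y k ∈ C then (0 : ℝ) else 1) := by
        calc (k : ℝ) = ∑ j ∈ Finset.range k, (if y j ∈ C then (0 : ℝ) else 1) := by
              rw [Finset.sum_congr rfl fun j hj => if_neg (hmin j (Finset.mem_range.1 hj))]
              simp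
          _ ≤ _ := Finset.sum_le_sum_of_subset_of_nonneg (Finset.range_mono hlt.le)
              fun j _ _ => by split_ifs <;> norm_num
      have h4 := mul_le_mul_of_nonneg_left h3 (a := 1 / ((d : ℝ) + 1)) (by positivity)
      push_cast
      linarith
    · push Not at hC
      refine (min_le_right _ _).trans ?_
      rw [← ENNReal.ofReal_natCast]
      refine ENNReal.ofReal_le_ofReal ?_
      have h3 : ∑ k ∈ Finset.range (M * (d + 1)), (if y k ∈ C then (0 : ℝ) else 1) =
          M * ((d : ℝ) + 1) := by
        rw [Finset.sum_congr rfl fun j hj => if_neg (hC j (Finset.mem_range.1 hj))]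
        simp
      have h4 : 1 / ((d : ℝ) + 1) * (M * ((d : ℝ) + 1)) = M := by
        field_simp
      rw [h3, h4]
      linarith
  · push Not at hB
    obtain ⟨k, hk, hBk⟩ := hB
    refine (min_le_right _ _).trans ?_
    rw [← ENNReal.ofReal_natCast]
    refine ENNReal.ofReal_le_ofReal ?_
    have h3 : 1 ≤ ∑ k ∈ Finset.range (M * (d + 1)), (if B k then (1 : ℝ) else 0) := by
      calc (1 : ℝ) = if B k then 1 else 0 := by rw [if_pos hBk]
        _ ≤ _ := Finset.single_le_sum (f := fun k => if B k then (1 : ℝ) else 0)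
          (fun j _ => by split_ifs <;> norm_num) (Finset.mem_range.2 hk)
    have h4 := mul_le_mul_of_nonneg_left h3 (a := (M : ℝ)) (by positivity)
    linarith

end HittingTime

/-! ### Poisson arrivals on a grid, and the limit of vanishing mesh -/

section Dynamics

variable {V : Type*} [Fintype V] [DecidableEq V] {G : SimpleGraph V} [DecidableRel G.Adj]
  {Ω : Type*}

/-- The numbers of arrivals on the edges during the `k`-th time interval of length `δ`. -/
def arrivalCounts (N : G.edgeSet → ℝ≥0 → Ω → ℕ) (δ : ℝ≥0) (k : ℕ) (ω : Ω) (e : G.edgeSet) : ℕ :=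
  N e (((k + 1 : ℕ) : ℝ≥0) * δ) ω - N e ((k : ℝ≥0) * δ) ω

/-- The event that there are two or more arrivals during the `k`-th time interval. -/
def multipleArrivals (N : G.edgeSet → ℝ≥0 → Ω → ℕ) (δ : ℝ≥0) (k : ℕ) : Set Ω :=
  {ω | arrivalCounts N δ k ω ≠ 0 ∧ ∀ e, arrivalCounts N δ k ω ≠ Pi.single e 1}

/-- Without multiple arrivals, the path agrees with the chain on the grid. -/
lemma eq_countChain_of_notMem_multipleArrivals {N : G.edgeSet → ℝ≥0 → Ω → ℕ} {δ : ℝ≥0}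
    {x₀ : V → ℤ} {x : ℝ≥0 → V → ℤ} {ω : Ω}
    (hx : IsQuantizedPath G (fun e t => N e t ω) x₀ x) (hmono : ∀ e, Monotone fun t => N e t ω)
    {m : ℕ} (hm : ∀ k < m, ω ∉ multipleArrivals N δ k) :
    ∀ k ≤ m, x ((k : ℝ≥0) * δ) = countChain x₀ (fun j => arrivalCounts N δ j ω) k := by
  intro k
  induction k with
  | zero => intro _; simpa [countChain] using hx.init
  | succ k ih =>
    intro hk
    have ih := ih (by omega)
    have hle : (k : ℝ≥0) * δ ≤ ((k + 1 : ℕ) : ℝ≥0) * δ := by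
      gcongr
      simp
    have hNle := fun e => hmono e hle
    rw [countChain, ← ih]
    by_cases h0 : arrivalCounts N δ k ω = 0
    · rw [h0, countUpdate_of_ne]
      · refine hx.noArrival _ _ hle fun e => ?_
        have h1 := congrFun h0 e
        have h2 := hNle e
        simp only [arrivalCounts, Pi.zero_apply] at h1 h2
        omega
      · intro e h
        simpa using congrFun h e
    · have h := hm k (by omega)
      simp only [multipleArrivals, Set.mem_ofPred_eq, not_and, not_forall, not_not] at h
      obtain ⟨e, he⟩ := h h0
      rw [he, countUpdate_single]
      have h1 : ∀ e', N e' (((k + 1 : ℕ) : ℝ≥0) * δ) ω =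
          N e' ((k : ℝ≥0) * δ) ω + (Pi.single e 1 : G.edgeSet → ℕ) e' := fun e' => by
        have h1 := congrFun he e'
        have h2 := hNle e'
        simp only [arrivalCounts] at h1 h2
        omega
      obtain ⟨⟨i, j⟩, hij⟩ := e
      refine hx.oneArrival _ _ hle i j hij ?_ fun e' he' => ?_
      · have := h1 ⟨s(i, j), hij⟩
        simpa using this
      · have := h1 e'
        rw [Pi.single_eq_of_ne he'] at this
        simpa using this

/-- The total rate of the edges. -/
noncomputable def totalRate (G : SimpleGraph V) [DecidableRel G.Adj] : ℝ :=
  ∑ e : G.edgeSet, (edgeRate e : ℝ)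

variable [MeasurableSpace Ω] {P : Measure Ω} {N : G.edgeSet → ℝ≥0 → Ω → ℕ} {x₀ : V → ℤ} {X : ℝ≥0 → Ω → V → ℤ}

lemma IsQuantizedMetropolisDynamics.isPoissonProcess
    (hD : IsQuantizedMetropolisDynamics G P N x₀ X) (e : G.edgeSet) :
    IsPoissonProcess (N e) (edgeRate e) P := by
  obtain ⟨⟨i, j⟩, h⟩ := e
  exact hD.poisson i j h

lemma IsQuantizedMetropolisDynamics.measurable_arrivalCounts
    (hD : IsQuantizedMetropolisDynamics G P N x₀ X) (δ : ℝ≥0) (k : ℕ) :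
    Measurable (arrivalCounts N δ k) :=
  measurable_pi_lambda _ fun e => ((hD.isPoissonProcess e).measurable _).sub
    ((hD.isPoissonProcess e).measurable _)

/-- Independence between edges and independence of increments on each edge combine to joint
independence over all pairs of an edge and an interval. -/
lemma IsQuantizedMetropolisDynamics.iIndepFun_arrivalCounts
    (hD : IsQuantizedMetropolisDynamics G P N x₀ X) (δ : ℝ≥0) :
    iIndepFun (fun (p : G.edgeSet × ℕ) ω => arrivalCounts N δ p.2 ω p.1) P := by
  refine iIndepFun_uncurry' (X := fun e k ω => arrivalCounts N δ k ω e) (fun e k => ?_) ?_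
    fun e => ?_
  · exact (measurable_pi_apply e).comp (hD.measurable_arrivalCounts δ k)
  · exact hD.indep.comp (fun e (path : ℝ≥0 → ℕ) (k : ℕ) =>
      path (((k + 1 : ℕ) : ℝ≥0) * δ) - path ((k : ℝ≥0) * δ)) fun e =>
      measurable_pi_lambda _ fun k => (measurable_pi_apply _).sub (measurable_pi_apply _)
  · exact (hD.isPoissonProcess e).indepIncrements.nat (t := fun k : ℕ => (k : ℝ≥0) * δ)
      fun a b hab => by
        simp only
        gcongr

lemma IsQuantizedMetropolisDynamics.measurableSet_multipleArrivals
    (hD : IsQuantizedMetropolisDynamics G P N x₀ X) (δ : ℝ≥0) (k : ℕ) :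
    MeasurableSet (multipleArrivals N δ k) :=
  hD.measurable_arrivalCounts δ k
    (MeasurableSet.of_discrete (s := {ν | ν ≠ 0 ∧ ∀ e, ν ≠ Pi.single e 1}))

lemma IsQuantizedMetropolisDynamics.indepFun_countChain
    (hD : IsQuantizedMetropolisDynamics G P N x₀ X) (δ : ℝ≥0) (k : ℕ) :
    IndepFun (fun ω => countChain x₀ (fun j => arrivalCounts N δ j ω) k)
      (arrivalCounts N δ k) P := by
  classical
  have hdisj : Disjoint ((Finset.univ : Finset G.edgeSet) ×ˢ Finset.range k)
      ((Finset.univ : Finset G.edgeSet) ×ˢ {k}) := by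
    rw [Finset.disjoint_left]
    rintro ⟨e, j⟩ h1 h2
    simp only [Finset.mem_product, Finset.mem_univ, Finset.mem_range, true_and,
      Finset.mem_singleton] at h1 h2
    omega
  have h := (hD.iIndepFun_arrivalCounts δ).indepFun_finset _ _ hdisj fun p =>
    (measurable_pi_apply p.1).comp (hD.measurable_arrivalCounts δ p.2)
  -- The chain at step k reads only the counts of intervals before k, so the default 0 elsewhere is
  -- immaterial.
  let φ : (((Finset.univ : Finset G.edgeSet) ×ˢ Finset.range k : Finset _) → ℕ) → V → ℤ :=
    fun z => countChain x₀ (fun j e => if hj : (e, j) ∈ (Finset.univ : Finset G.edgeSet) ×ˢ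
      Finset.range k then z ⟨(e, j), hj⟩ else 0) k
  let ψ : (((Finset.univ : Finset G.edgeSet) ×ˢ {k} : Finset (G.edgeSet × ℕ)) → ℕ) →
    G.edgeSet → ℕ := fun z e => z ⟨(e, k), by simp⟩
  have h' := h.comp (φ := φ) (ψ := ψ) Measurable.of_discrete Measurable.of_discrete
  convert h' using 1
  · ext1 ω
    refine countChain_congr x₀ fun j hj => ?_
    ext e
    simp [hj]
  · rfl

lemma IsQuantizedMetropolisDynamics.measureReal_arrivalCounts
    (hD : IsQuantizedMetropolisDynamics G P N x₀ X) (δ : ℝ≥0) (k : ℕ) (ν : G.edgeSet → ℕ) :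
    P.real (arrivalCounts N δ k ⁻¹' {ν}) = ∏ e : G.edgeSet,
      (Real.exp (-(edgeRate e * δ)) * (edgeRate e * δ) ^ ν e / (ν e).factorial : ℝ) := by
  have hind := (hD.iIndepFun_arrivalCounts δ).precomp (g := fun e : G.edgeSet => (e, k))
    fun a b h => (Prod.mk.inj h).1
  have h := hind.measure_inter_preimage_eq_mul Finset.univ (sets := fun e => {ν e})
    fun e _ => measurableSet_singleton _
  have hset : arrivalCounts N δ k ⁻¹' {ν} =
      ⋂ e ∈ (Finset.univ : Finset G.edgeSet), (fun ω => arrivalCounts N δ k ω e) ⁻¹' {ν e} := by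
    ext ω
    simp [funext_iff]
  rw [measureReal_def, hset, h, ENNReal.toReal_prod]
  refine Finset.prod_congr rfl fun e _ => ?_
  have hlaw := (hD.isPoissonProcess e).law ((k : ℝ≥0) * δ) (((k + 1 : ℕ) : ℝ≥0) * δ) (by
    gcongr
    simp)
  have hsub : ((k + 1 : ℕ) : ℝ≥0) * δ - (k : ℝ≥0) * δ = δ := by
    push_cast
    rw [add_mul, one_mul, add_tsub_cancel_left]
  rw [hsub] at hlaw
  have hm : Measurable fun ω => N e (((k + 1 : ℕ) : ℝ≥0) * δ) ω - N e ((k : ℝ≥0) * δ) ω :=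
    ((hD.isPoissonProcess e).measurable _).sub ((hD.isPoissonProcess e).measurable _)
  have h1 := poissonMeasure_real_singleton (edgeRate e * δ) (ν e)
  rw [← hlaw, map_measureReal_apply hm (measurableSet_singleton _)] at h1
  rw [← measureReal_def]
  refine Eq.trans h1 ?_
  push_cast
  rfl

lemma IsQuantizedMetropolisDynamics.measureReal_arrivalCounts_zero
    (hD : IsQuantizedMetropolisDynamics G P N x₀ X) (δ : ℝ≥0) (k : ℕ) :
    P.real (arrivalCounts N δ k ⁻¹' {0}) = Real.exp (-(totalRate G * δ)) := by
  rw [hD.measureReal_arrivalCounts, totalRate, Finset.sum_mul, ← Finset.sum_neg_distrib,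
    Real.exp_sum]
  simp

/-- The factor in front of `edgeRate e` is the same for all edges, as `integral_countUpdate`
requires of q. -/
lemma IsQuantizedMetropolisDynamics.measureReal_arrivalCounts_single
    (hD : IsQuantizedMetropolisDynamics G P N x₀ X) (δ : ℝ≥0) (k : ℕ) (e : G.edgeSet) :
    P.real (arrivalCounts N δ k ⁻¹' {Pi.single e 1}) =
      δ * Real.exp (-(totalRate G * δ)) * edgeRate e := by
  have h : ∏ e' : G.edgeSet, ((edgeRate e' * δ : ℝ) ^ (Pi.single e 1 : G.edgeSet → ℕ) e' /
      ((Pi.single e 1 : G.edgeSet → ℕ) e').factorial) = edgeRate e * δ := by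
    rw [Finset.prod_eq_single e]
    · simp
    · intro e' _ hne
      simp [hne]
    · simp
  rw [hD.measureReal_arrivalCounts]
  simp_rw [mul_div_assoc]
  rw [Finset.prod_mul_distrib, h, totalRate, Finset.sum_mul, ← Finset.sum_neg_distrib,
    Real.exp_sum]
  ring

variable [IsProbabilityMeasure P]

/-- With r the mean number of arrivals, 1 - (1 + r) exp (-r) ≤ 1 - (1 + r) (1 - r) = r². -/
lemma IsQuantizedMetropolisDynamics.measureReal_multipleArrivals_le
    (hD : IsQuantizedMetropolisDynamics G P N x₀ X) (δ : ℝ≥0) (k : ℕ) :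
    P.real (multipleArrivals N δ k) ≤ (totalRate G * δ) ^ 2 := by
  classical
  set S : Finset (G.edgeSet → ℕ) := insert 0 (Finset.univ.image fun e => Pi.single e 1)
  have hset : multipleArrivals N δ k = (arrivalCounts N δ k ⁻¹' S)ᶜ := by
    ext ω
    simp [multipleArrivals, S, eq_comm]
  have hms : MeasurableSet (arrivalCounts N δ k ⁻¹' S) :=
    hD.measurable_arrivalCounts δ k MeasurableSet.of_discrete
  have hS : P.real (arrivalCounts N δ k ⁻¹' S) =
      Real.exp (-(totalRate G * δ)) * (1 + totalRate G * δ) := by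
    rw [← sum_measureReal_preimage_singleton S fun ν _ =>
      hD.measurable_arrivalCounts δ k (measurableSet_singleton ν), Finset.sum_insert,
      Finset.sum_image fun a _ b _ h => single_one_injective h]
    · simp_rw [hD.measureReal_arrivalCounts_single]
      rw [hD.measureReal_arrivalCounts_zero, ← Finset.mul_sum, ← totalRate]
      ring
    · simp only [Finset.mem_image, Finset.mem_univ, true_and, not_exists]
      intro e h
      simpa using congrFun h e
  have hR : 0 ≤ totalRate G * δ :=
    mul_nonneg (Finset.sum_nonneg fun _ _ => NNReal.coe_nonneg _) δ.2
  rw [hset, probReal_compl_eq_one_sub hms, hS]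
  nlinarith [Real.one_sub_le_exp_neg (totalRate G * δ)]

lemma IsQuantizedMetropolisDynamics.lintegral_min_le
    (hD : IsQuantizedMetropolisDynamics G P N x₀ X) {l L : ℤ} (hx₀ : ∀ i, l ≤ x₀ i ∧ x₀ i ≤ L)
    {Φ : (V → ℤ) → ℝ} (hΦ0 : ∀ x, 0 ≤ Φ x) {C : Set (V → ℤ)}
    (hΦ : ∀ x, ∑ i, x i = ∑ i, x₀ i → configGenerator G Φ x ≤ -Cᶜ.indicator 1 x) (M d : ℕ) :
    ∫⁻ ω, min (rationalHittingTime C fun t => X t ω) M ∂P ≤ ENNReal.ofReal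
      (Real.exp (totalRate G * (1 / ((d : ℝ) + 1))) * Φ x₀ +
        (M * totalRate G) ^ 2 * (1 / ((d : ℝ) + 1))) := by
  classical
  set δ : ℝ≥0 := 1 / ((d : ℝ≥0) + 1) with hδ
  have hδ' : (δ : ℝ) = 1 / ((d : ℝ) + 1) := by simp [hδ]
  set Y : ℕ → Ω → V → ℤ := fun k ω => countChain x₀ (fun j => arrivalCounts N δ j ω) k with hYdef
  have hY : ∀ k, Measurable (Y k) := measurable_countChain (hD.measurable_arrivalCounts δ) x₀
  have hYC : ∀ k, MeasurableSet {ω | Y k ω ∉ C} := fun k =>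
    hY k (MeasurableSet.of_discrete (s := Cᶜ))
  have hmono : ∀ᵐ ω ∂P, ∀ e, Monotone fun t => N e t ω :=
    ae_all_iff.2 fun e => (hD.isPoissonProcess e).monotone
  set F : Ω → ℝ := fun ω => δ * ∑ k ∈ Finset.range (M * (d + 1)), {ω | Y k ω ∉ C}.indicator 1 ω +
    M * ∑ k ∈ Finset.range (M * (d + 1)), (multipleArrivals N δ k).indicator 1 ω with hF
  have hF1 : ∀ k, Integrable ({ω | Y k ω ∉ C}.indicator (1 : Ω → ℝ)) P := fun k =>
    (integrable_const (1 : ℝ)).indicator (hYC k)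
  have hF2 : ∀ k, Integrable ((multipleArrivals N δ k).indicator (1 : Ω → ℝ)) P := fun k =>
    (integrable_const (1 : ℝ)).indicator (hD.measurableSet_multipleArrivals δ k)
  have hS1 := integrable_finsetSum (Finset.range (M * (d + 1))) fun k _ => hF1 k
  have hS2 := integrable_finsetSum (Finset.range (M * (d + 1))) fun k _ => hF2 k
  have hFint : Integrable F P := (hS1.const_mul _).add (hS2.const_mul _)
  have hF0 : ∀ ω, 0 ≤ F ω := fun ω => by
    have h1 : 0 ≤ ∑ k ∈ Finset.range (M * (d + 1)), {ω | Y k ω ∉ C}.indicator (1 : Ω → ℝ) ω :=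
      Finset.sum_nonneg fun k _ => Set.indicator_nonneg (fun _ _ => zero_le_one) _
    have h2 : 0 ≤ ∑ k ∈ Finset.range (M * (d + 1)),
        (multipleArrivals N δ k).indicator (1 : Ω → ℝ) ω :=
      Finset.sum_nonneg fun k _ => Set.indicator_nonneg (fun _ _ => zero_le_one) _
    positivity
  have hle : ∀ᵐ ω ∂P, min (rationalHittingTime C fun t => X t ω) M ≤ ENNReal.ofReal (F ω) := by
    filter_upwards [hD.path, hmono] with ω hω hmω
    have h := min_rationalHittingTime_le C (fun t => X t ω) M d (fun k => Y k ω)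
      (fun k => ω ∈ multipleArrivals N δ k)
      fun hB => eq_countChain_of_notMem_multipleArrivals hω hmω hB
    refine h.trans (le_of_eq ?_)
    rw [hF, ← hδ']
    simp only [Set.indicator_apply, Set.mem_ofPred_eq, Pi.one_apply, ite_not]
  calc _ ≤ ∫⁻ ω, ENNReal.ofReal (F ω) ∂P := lintegral_mono_ae hle
    _ = ENNReal.ofReal (∫ ω, F ω ∂P) :=
      (ofReal_integral_eq_lintegral_ofReal hFint (Filter.Eventually.of_forall hF0)).symm
    _ ≤ _ := ENNReal.ofReal_le_ofReal ?_
  have hFval : ∫ ω, F ω ∂P = δ * ∑ k ∈ Finset.range (M * (d + 1)), P.real {ω | Y k ω ∉ C} +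
      M * ∑ k ∈ Finset.range (M * (d + 1)), P.real (multipleArrivals N δ k) := by
    rw [hF, integral_add (hS1.const_mul _) (hS2.const_mul _), integral_const_mul,
      integral_const_mul, integral_finsetSum _ fun k _ => hF1 k,
      integral_finsetSum _ fun k _ => hF2 k]
    simp_rw [integral_indicator_one (hYC _),
      integral_indicator_one (hD.measurableSet_multipleArrivals δ _)]
  rw [hFval, ← hδ']
  have h1 := sum_measure_countChain_le (hD.measurable_arrivalCounts δ) (hD.indepFun_countChain δ)
    hx₀ (q := δ * Real.exp (-(totalRate G * δ))) (by positivity)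
    (hD.measureReal_arrivalCounts_single δ) hΦ0 hΦ (M * (d + 1))
  have h2 : ∑ k ∈ Finset.range (M * (d + 1)), P.real (multipleArrivals N δ k) ≤
      (M * (d + 1) : ℕ) * (totalRate G * δ) ^ 2 := by
    calc _ ≤ ∑ k ∈ Finset.range (M * (d + 1)), (totalRate G * δ) ^ 2 :=
          Finset.sum_le_sum fun k _ => hD.measureReal_multipleArrivals_le δ k
      _ = _ := by simp
  -- The factor exp (R δ), with R the total rate, compensates exp (-R δ) in q. The error is M · M (d
  -- + 1) · (R δ)² = (M R)² δ, since (d + 1) δ = 1.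
  refine add_le_add ?_ ?_
  · have h3 := mul_le_mul_of_nonneg_left h1 (Real.exp_nonneg (totalRate G * δ))
    refine le_trans (le_of_eq ?_) h3
    rw [Real.exp_neg]
    field_simp
    rfl
  · have h3 := mul_le_mul_of_nonneg_left h2 (a := (M : ℝ)) (by positivity)
    refine h3.trans (le_of_eq ?_)
    rw [hδ']
    push_cast
    field_simp

/-- A Lyapunov function bounds the expected hitting time. -/
theorem IsQuantizedMetropolisDynamics.lintegral_hittingTime_le
    (hD : IsQuantizedMetropolisDynamics G P N x₀ X) {l L : ℤ} (hx₀ : ∀ i, l ≤ x₀ i ∧ x₀ i ≤ L)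
    {Φ : (V → ℤ) → ℝ} (hΦ0 : ∀ x, 0 ≤ Φ x) {C : Set (V → ℤ)}
    (hΦ : ∀ x, ∑ i, x i = ∑ i, x₀ i → configGenerator G Φ x ≤ -Cᶜ.indicator 1 x) :
    ∫⁻ ω, hittingTime C (fun t => X t ω) ∂P ≤ ENNReal.ofReal (Φ x₀) := by
  have hM : ∀ M : ℕ, ∫⁻ ω, min (rationalHittingTime C fun t => X t ω) M ∂P ≤
      ENNReal.ofReal (Φ x₀) := fun M => by
    -- The mesh tends to 0 with M fixed; only afterwards is the truncation removed, by monotone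
    -- convergence.
    refine ge_of_tendsto' (f := fun d : ℕ => ENNReal.ofReal
      (Real.exp (totalRate G * (1 / ((d : ℝ) + 1))) * Φ x₀ +
        (M * totalRate G) ^ 2 * (1 / ((d : ℝ) + 1)))) (x := Filter.atTop) ?_
      (hD.lintegral_min_le hx₀ hΦ0 hΦ M)
    refine ENNReal.tendsto_ofReal ?_
    have h0 := tendsto_one_div_add_atTop_nhds_zero_nat (𝕜 := ℝ)
    have h1 := (((Real.continuous_exp.tendsto _).comp (h0.const_mul (totalRate G))).mul_const
      (Φ x₀)).add (h0.const_mul ((M * totalRate G) ^ 2))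
    simpa using h1
  calc _ ≤ ∫⁻ ω, rationalHittingTime C (fun t => X t ω) ∂P :=
        lintegral_mono fun ω => hittingTime_le_rationalHittingTime C _
    _ = ∫⁻ ω, ⨆ M : ℕ, min (rationalHittingTime C fun t => X t ω) M ∂P := by
        refine lintegral_congr fun ω => ?_
        rw [← inf_iSup_eq, ENNReal.iSup_natCast, inf_top_eq]
    _ = ⨆ M : ℕ, ∫⁻ ω, min (rationalHittingTime C fun t => X t ω) M ∂P := by
        refine lintegral_iSup (fun M =>
          (measurable_rationalHittingTime hD.measurable C).min measurable_const) ?_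
        intro M M' h ω
        exact min_le_min_left _ (by exact_mod_cast h)
    _ ≤ _ := iSup_le hM

end Dynamics

end QuantizedMetropolis

/-! ### The final estimate -/

theorem mainTheorem2 :
    ∃ K : ℝ, 0 < K ∧
      ∀ {V : Type*} [Fintype V] [DecidableEq V] (G : SimpleGraph V) [DecidableRel G.Adj],
        G.Connected →
      ∀ (l L : ℤ) (x₀ : V → ℤ), (∀ i, l ≤ x₀ i ∧ x₀ i ≤ L) →
      ∀ {Ω : Type*} [MeasurableSpace Ω] (P : Measure Ω) [IsProbabilityMeasure P]
        (N : G.edgeSet → ℝ≥0 → Ω → ℕ) (X : ℝ≥0 → Ω → V → ℤ),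
        QuantizedMetropolis.IsQuantizedMetropolisDynamics G P N x₀ X →
        ∫⁻ ω, QuantizedMetropolis.hittingTime (QuantizedMetropolis.consensusSet x₀)
            (fun t => X t ω) ∂P
          ≤ ENNReal.ofReal
              (K * ((L : ℝ) - l) * (Fintype.card V : ℝ) ^ 2 * Real.log (Fintype.card V)) := by
  -- 384 = 96 · 4, with 1 + 2n² ≤ n⁴ for n ≥ 2.
  refine ⟨384, by norm_num, ?_⟩
  intro V _ _ G _ hG l L x₀ hx₀ Ω _ P _ N X hD
  have := hG.nonempty
  -- Starting in consensus gives hitting time 0, which disposes of n = 1 and l = L, where the bound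
  -- is 0. Otherwise the initial spread is at least 2, so n ≥ 2 and l < L.
  by_cases hC : x₀ ∈ QuantizedMetropolis.consensusSet x₀
  · have h0 : ∀ᵐ ω ∂P, QuantizedMetropolis.hittingTime (QuantizedMetropolis.consensusSet x₀)
        (fun t => X t ω) = 0 := by
      filter_upwards [hD.path] with ω hω
      refine le_antisymm ?_ bot_le
      refine (iInf₂_le (0 : ℝ≥0) ?_).trans (by simp)
      have h : X 0 ω = x₀ := hω.init
      simpa only [h] using hC
    rw [lintegral_congr_ae h0]
    simp
  · have hspread : ¬ QuantizedMetropolis.maxValue x₀ - QuantizedMetropolis.minValue x₀ ≤ 1 :=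
      fun h => hC (QuantizedMetropolis.mem_consensusSet rfl h)
    obtain ⟨a, ha⟩ := QuantizedMetropolis.exists_eq_minValue x₀
    obtain ⟨b, hb⟩ := QuantizedMetropolis.exists_eq_maxValue x₀
    have hlL : l < L := by
      have := (hx₀ a).1
      have := (hx₀ b).2
      omega
    have hab : a ≠ b := fun h => by
      subst h
      omega
    have hcard : (2 : ℝ) ≤ Fintype.card V := by
      exact_mod_cast Fintype.one_lt_card_iff.2 ⟨a, b, hab⟩
    obtain ⟨Φ, hΦ0, hΦle, hΦ⟩ := QuantizedMetropolis.exists_lyapunov hG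
    refine (hD.lintegral_hittingTime_le hx₀ hΦ0 (hΦ x₀)).trans (ENNReal.ofReal_le_ofReal ?_)
    refine (hΦle l L x₀ hlL hx₀).trans ?_
    have hlog : Real.log (1 + 2 * (Fintype.card V : ℝ) ^ 2) ≤ 4 * Real.log (Fintype.card V) := by
      rw [← Real.log_rpow (by linarith)]
      refine Real.log_le_log (by positivity) ?_
      norm_num
      nlinarith [mul_self_nonneg ((Fintype.card V : ℝ) ^ 2 - 2)]
    have hlL' : (0 : ℝ) ≤ (L : ℝ) - l := by
      rw [sub_nonneg]
      exact_mod_cast hlL.le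
    calc _ ≤ 96 * ((L : ℝ) - l) * (Fintype.card V : ℝ) ^ 2 *
          (4 * Real.log (Fintype.card V)) := by gcongr
      _ = _ := by ring
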